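/- For each $n\ge 1$ let $A$ be an $m_1\times n$ and $B$ an $m_2\times n$ random matrix, all entries of $A$ and $B$ together being i.i.d. standard normal, where $m_1=m_1(n)$, $m_2=m_2(n)$ satisfy $m_1/n\to\alpha_1$ and $m_2/n\to\alpha_2$ as $n\to\infty$, for constants $\alpha_1,\alpha_2\ge 0$ (for instance $m_1=\alpha_1 n$, $m_2=\alpha_2 n$). Put $$\xi_h=\min\Big\{\sum_{i=1}^n x_i : x\in\mathbb R^n,\ Ax=0,\ Bx\le 0,\ \|x\|_2\le 1\Big\}.$$ For $\epsilon_1,\epsilon_5>0$ independent of $n$ let $d_l=(1-\epsilon_1)\sqrt{\alpha_1+\alpha_2/2}-\epsilon_5$, $d_u=(1+\epsilon_1)\sqrt{\alpha_1+\alpha_2/2}+\epsilon_5$, and $$\xi_D^{(l)}=\begin{cases}-\sqrt{1-d_l^2}\,\sqrt n,& d_l^2\le 1\\ 0,&\text{otherwise,}\end{cases}\qquad \xi_D^{(u)}=\begin{cases}-\sqrt{1-d_u^2}\,\sqrt n,& d_u^2\le 1\\ 0,&\text{otherwise.}\end{cases}$$ (a) Let $\epsilon_1,\epsilon_5>0$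 be small enough that $d_l\ge 0$. Then $\lim_{n\to\infty}P(\xi_D^{(l)}\le\xi_h\le\xi_D^{(u)})=1$. If $d_l<1$, then moreover $\lim_{n\to\infty}P(\xi_D^{(l)}<\xi_h\le\xi_D^{(u)})=1$. If $\alpha_1+\alpha_2/2<1$, then moreover $\lim_{n\to\infty}P(\xi_D^{(l)}<\xi_h<\xi_D^{(u)})=1$. (b) If $\alpha_1+\alpha_2/2<1$, then for every $\delta>0$, $\lim_{n\to\infty}P\big(|\xi_h+\sqrt{1-\alpha_1-\alpha_2/2}\,\sqrt n|\le\delta\sqrt n\big)=1$. If $\alpha_1+\alpha_2/2\ge 1$, then for every $\delta>0$, $\lim_{n\to\infty}P(|\xi_h|\le\delta\sqrt n)=1$. If $\alpha_1+\alpha_2/2>1$, then $\lim_{n\to\infty}P(\xi_h=0)=1$. -/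

import Mathlib

open MeasureTheory ProbabilityTheory Filter Topology
open scoped Matrix

noncomputable section

namespace RandomLinearProgram

/-- The feasible set `A x = 0`, `B x ≤ 0` (componentwise), `‖x‖₂ ≤ 1`. -/
def feasible {m₁ m₂ n : ℕ} (A : Matrix (Fin m₁) (Fin n) ℝ) (B : Matrix (Fin m₂) (Fin n) ℝ) :
    Set (EuclideanSpace ℝ (Fin n)) :=
  {x | A *ᵥ x.ofLp = 0 ∧ (∀ i, (B *ᵥ x.ofLp) i ≤ 0) ∧ ‖x‖ ≤ 1}

/-- The optimal value of `min f(x)` over the feasible set. For the linear objective below it is an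
attained minimum, see `isLeast_xiH`. -/
def xiH {m₁ m₂ n : ℕ} (f : EuclideanSpace ℝ (Fin n) → ℝ)
    (A : Matrix (Fin m₁) (Fin n) ℝ) (B : Matrix (Fin m₂) (Fin n) ℝ) : ℝ :=
  sInf (f '' feasible A B)

/-- The purely linear objective `∑ xᵢ`. -/
def fLp {n : ℕ} (x : EuclideanSpace ℝ (Fin n)) : ℝ := ∑ i, x i

theorem isLeast_xiH {m₁ m₂ n : ℕ} (A : Matrix (Fin m₁) (Fin n) ℝ)
    (B : Matrix (Fin m₂) (Fin n) ℝ) : IsLeast (fLp '' feasible A B) (xiH fLp A B) := by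
  have hc : IsCompact (feasible A B) := by
    refine (isCompact_closedBall (0 : EuclideanSpace ℝ (Fin n)) 1).of_isClosed_subset ?_ ?_
    · have h1 : Continuous fun x : EuclideanSpace ℝ (Fin n) => A *ᵥ x.ofLp := by fun_prop
      have h2 : Continuous fun x : EuclideanSpace ℝ (Fin n) => B *ᵥ x.ofLp := by fun_prop
      have h3 : IsClosed {x : EuclideanSpace ℝ (Fin n) | ∀ i, (B *ᵥ x.ofLp) i ≤ 0} := by
        simp only [Set.ofPred_forall]
        exact isClosed_iInter fun i =>
          isClosed_le ((continuous_apply i).comp h2) continuous_const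
      exact (isClosed_eq h1 continuous_const).inter
        (h3.inter (isClosed_le continuous_norm continuous_const))
    · intro x hx
      simpa using hx.2.2
  have hf : Continuous (fLp : EuclideanSpace ℝ (Fin n) → ℝ) := by
    unfold fLp
    fun_prop
  exact (hc.image hf).isLeast_sInf ⟨fLp 0, 0, by simp [feasible], rfl⟩

/-- `√D⁽ˡ⁾ = (1 - ε₁) √(α₁ + α₂/2) - ε₅`. -/
def sqrtDl (ε₁ ε₅ α₁ α₂ : ℝ) : ℝ := (1 - ε₁) * √(α₁ + α₂ / 2) - ε₅

/-- `√D⁽ᵘ⁾ = (1 + ε₁) √(α₁ + α₂/2) + ε₅`. -/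
def sqrtDu (ε₁ ε₅ α₁ α₂ : ℝ) : ℝ := (1 + ε₁) * √(α₁ + α₂ / 2) + ε₅

/-- The lower bound `ξ_D⁽ˡ⁾`. -/
def xiDl (ε₁ ε₅ α₁ α₂ : ℝ) (n : ℕ) : ℝ :=
  if sqrtDl ε₁ ε₅ α₁ α₂ ^ 2 ≤ 1 then -√(1 - sqrtDl ε₁ ε₅ α₁ α₂ ^ 2) * √n else 0

/-- The upper bound `ξ_D⁽ᵘ⁾`. -/
def xiDu (ε₁ ε₅ α₁ α₂ : ℝ) (n : ℕ) : ℝ :=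
  if sqrtDu ε₁ ε₅ α₁ α₂ ^ 2 ≤ 1 then -√(1 - sqrtDu ε₁ ε₅ α₁ α₂ ^ 2) * √n else 0

/-- All entries of the two random matrices `A` and `B` together form an independent family of
standard normal random variables. -/
structure IsIIDStdGaussian {Ω : Type*} [MeasurableSpace Ω] (μ : Measure Ω) {m₁ m₂ n : ℕ}
    (A : Ω → Matrix (Fin m₁) (Fin n) ℝ) (B : Ω → Matrix (Fin m₂) (Fin n) ℝ) : Prop where
  hasLaw : ∀ p : (Fin m₁ ⊕ Fin m₂) × Fin n,
    HasLaw (fun ω => Matrix.fromRows (A ω) (B ω) p.1 p.2) (gaussianReal 0 1) μ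
  indep : iIndepFun (fun (p : (Fin m₁ ⊕ Fin m₂) × Fin n) (ω : Ω) =>
    Matrix.fromRows (A ω) (B ω) p.1 p.2) μ

end RandomLinearProgram

end

noncomputable section

namespace RandomLinearProgram

open scoped InnerProductSpace

/-! ### Residuals of a vector with respect to a family of rows -/

section Residual

variable {E : Type*} [NormedAddCommGroup E] [InnerProductSpace ℝ E] {R : Type*}

/-! The Gaussian law is invariant under sign flips of the inequality rows and of the columns, so a
probability can be computed by fixing the array and averaging over all flips
(`card_mul_measure_le`). After a diagonal change of variables, the flipped program maximises `⟪s,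
y⟫`, for a sign vector `s`, over the unit ball of the cone with constraint signs `σ`. Its value is
minus the norm of the projection of `s` onto that cone (`arrayValue_flipArray`).

For almost every array the rows are generic (`ae_isGeneric`). Then a nonzero projection onto one of
the `2 ^ m₂` cones is the residual of `s` with respect to the equality rows and an active set `S`.
By the optimality conditions, every `S` with nonzero residual occurs for exactly one `σ`. Averaging
over `σ` is therefore averaging over a uniformly random subset `S` (`card_filter_isConeProj`), and
no cone geometry is left.

Now `|S|` has mean `m₂ / 2` and variance `m₂ / 4`, and the squared projection of a random sign
vector onto a fixed subspace of dimension `d` has mean `d` and variance at most `2n`; here `d = max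
0 (n - m₁ - |S|)`. Chebyshev puts `ξ_h²` within `o(n)` of `max 0 (n - m₁ - m₂ / 2)` in probability,
and `ξ_h ≤ 0` fixes the root. Above the threshold most `S` leave only the zero subspace, so `ξ_h`
vanishes exactly. -/

theorem mem_orthogonal_span_image {g : R → E} {T : Finset R} {x : E}
    (h : ∀ r ∈ T, ⟪g r, x⟫_ℝ = 0) : x ∈ (Submodule.span ℝ (g '' T))ᗮ := by
  rw [Submodule.mem_orthogonal]
  intro u hu
  induction hu using Submodule.span_induction with
  | mem u hu =>
    obtain ⟨r, hr, rfl⟩ := hu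
    exact h r hr
  | zero => simp
  | add a b _ _ ha hb => rw [inner_add_left, ha, hb, add_zero]
  | smul c a _ ha => rw [real_inner_smul_left, ha, mul_zero]

variable [FiniteDimensional ℝ E]

/-- The component of `v` orthogonal to all rows `g r`, `r ∈ T`. -/
def resid (g : R → E) (T : Finset R) (v : E) : E :=
  (Submodule.span ℝ (g '' T))ᗮ.starProjection v

theorem inner_row_resid (g : R → E) {T : Finset R} (v : E) {r : R} (hr : r ∈ T) :
    ⟪g r, resid g T v⟫_ℝ = 0 :=
  (Submodule.mem_orthogonal _ _).1 (Submodule.starProjection_apply_mem _ v) _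
    (Submodule.subset_span ⟨r, hr, rfl⟩)

theorem sub_resid_mem_span (g : R → E) (T : Finset R) (v : E) :
    v - resid g T v ∈ Submodule.span ℝ (g '' T) := by
  have h := Submodule.sub_starProjection_mem_orthogonal (K := (Submodule.span ℝ (g '' T))ᗮ) v
  rwa [Submodule.orthogonal_orthogonal] at h

theorem inner_sub_resid_resid (g : R → E) (T : Finset R) (v : E) :
    ⟪v - resid g T v, resid g T v⟫_ℝ = 0 :=
  (Submodule.mem_orthogonal _ _).1 (Submodule.starProjection_apply_mem _ v) _
    (sub_resid_mem_span g T v)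

theorem eq_resid {g : R → E} {T : Finset R} {v x : E} (h : ∀ r ∈ T, ⟪g r, x⟫_ℝ = 0)
    (hx : v - x ∈ Submodule.span ℝ (g '' T)) : resid g T v = x :=
  Submodule.eq_starProjection_of_mem_orthogonal (mem_orthogonal_span_image h)
    (by rwa [Submodule.orthogonal_orthogonal])

theorem resid_eq_self {g : R → E} {T : Finset R} {x : E} (h : ∀ r ∈ T, ⟪g r, x⟫_ℝ = 0) :
    resid g T x = x :=
  eq_resid h (by simp)

theorem inner_resid_comm (g : R → E) (T : Finset R) (a b : E) :
    ⟪a, resid g T b⟫_ℝ = ⟪b, resid g T a⟫_ℝ := by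
  rw [resid, ← Submodule.inner_starProjection_left_eq_right, real_inner_comm, resid]

theorem inner_self_resid (g : R → E) (T : Finset R) (a : E) :
    ⟪a, resid g T a⟫_ℝ = ‖resid g T a‖ ^ 2 := by
  have h := inner_sub_resid_resid g T a
  rw [inner_sub_left, real_inner_self_eq_norm_sq] at h
  linarith

/-- The residual map is self-adjoint and fixes `x`. When `v - x = ∑ c t • g t` over `T`, the left
side is `c r` times a squared norm, so the right side reveals the sign of the multiplier `c r`. -/
theorem inner_sub_resid_erase [DecidableEq R] {g : R → E} {T : Finset R} {v x : E} {r : R}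
    (hr : r ∈ T) (h : ∀ t ∈ T, ⟪g t, x⟫_ℝ = 0) :
    ⟪v - x, resid g (T.erase r) (g r)⟫_ℝ = ⟪g r, resid g (T.erase r) v⟫_ℝ := by
  have hx : resid g (T.erase r) x = x :=
    resid_eq_self fun t ht => h t (Finset.mem_of_mem_erase ht)
  rw [inner_sub_left, inner_resid_comm g _ v, inner_resid_comm g _ x, hx, h r hr, sub_zero]

/-- No row outside of `T` is orthogonal to a nonzero residual of `v` with respect to `T`. -/
def IsGeneric (g : R → E) (v : E) : Prop :=
  ∀ (T : Finset R) (r : R), r ∉ T → resid g T v ≠ 0 → ⟪g r, resid g T v⟫_ℝ ≠ 0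

/-- Needed to apply genericity to the row `r ∈ T` against the smaller set `T.erase r`. -/
theorem resid_erase_ne_zero [DecidableEq R] {g : R → E} {T : Finset R} {v : E} (r : R)
    (h : resid g T v ≠ 0) : resid g (T.erase r) v ≠ 0 := by
  intro h0
  refine h (eq_resid (by simp) ?_)
  have := sub_resid_mem_span g (T.erase r) v
  rw [h0] at this
  exact Submodule.span_mono (Set.image_mono (by simp)) this

end Residual

/-! ### Signs -/

/-- A sign as a real number. -/
def sgn (u : ℤˣ) : ℝ := ((u : ℤ) : ℝ)

theorem sgn_mul_self (u : ℤˣ) : sgn u * sgn u = 1 := by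
  rcases Int.units_eq_one_or u with rfl | rfl <;> simp [sgn]

theorem sgn_neg (u : ℤˣ) : sgn (-u) = -sgn u := by simp [sgn]

theorem sgn_one : sgn 1 = 1 := by simp [sgn]

theorem sgn_mul (u w : ℤˣ) : sgn (u * w) = sgn u * sgn w := by simp [sgn]

/-- The sign of a nonzero real number. -/
def signOf (a : ℝ) : ℤˣ := if 0 < a then 1 else -1

theorem sgn_signOf_mul_nonneg (a : ℝ) : 0 ≤ sgn (signOf a) * a := by
  unfold signOf sgn
  split_ifs with h
  · simpa using h.le
  · simpa using not_lt.1 h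

theorem eq_signOf {a : ℝ} (ha : a ≠ 0) {u : ℤˣ} (h : 0 ≤ sgn u * a) : u = signOf a := by
  unfold signOf
  rcases Int.units_eq_one_or u with rfl | rfl
  · have : 0 ≤ a := by simpa [sgn] using h
    rw [if_pos (lt_of_le_of_ne this ha.symm)]
  · have : a ≤ 0 := by simpa [sgn] using h
    rw [if_neg (not_lt.2 this)]

/-! ### Projections onto polyhedral cones with signed constraints -/

section Cone

variable {E : Type*} [NormedAddCommGroup E] [InnerProductSpace ℝ E]
  {ι κ : Type*}

/-- The cone cut out by equality constraints `g (inl i)` and signed inequality constraints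
`σ k • g (inr k)`. -/
def signedCone (g : ι ⊕ κ → E) (σ : κ → ℤˣ) : Set E :=
  {y | (∀ i, ⟪g (Sum.inl i), y⟫_ℝ = 0) ∧ ∀ k, sgn (σ k) * ⟪g (Sum.inr k), y⟫_ℝ ≤ 0}

/-- `x` is the metric projection of `v` onto the signed cone. -/
structure IsConeProj (g : ι ⊕ κ → E) (σ : κ → ℤˣ) (v x : E) : Prop where
  mem : x ∈ signedCone g σ
  inner_self : ⟪v - x, x⟫_ℝ = 0
  inner_le : ∀ y ∈ signedCone g σ, ⟪v - x, y⟫_ℝ ≤ 0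

theorem IsConeProj.unique {g : ι ⊕ κ → E} {σ : κ → ℤˣ} {v x x' : E} (h : IsConeProj g σ v x)
    (h' : IsConeProj g σ v x') : x = x' := by
  have h1 := h.inner_le x' h'.mem
  have h2 := h'.inner_le x h.mem
  have h3 : ‖x - x'‖ ^ 2 ≤ 0 := by
    have e1 := h.inner_self
    have e2 := h'.inner_self
    rw [← real_inner_self_eq_norm_sq]
    simp only [inner_sub_left, inner_sub_right] at *
    rw [real_inner_comm x x'] at *
    linarith
  have h4 : ‖x - x'‖ = 0 := by nlinarith [norm_nonneg (x - x')]
  exact sub_eq_zero.1 (norm_eq_zero.1 h4)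

theorem exists_isConeProj [FiniteDimensional ℝ E] (g : ι ⊕ κ → E) (σ : κ → ℤˣ) (v : E) :
    ∃ x, IsConeProj g σ v x := by
  have h0 : (0 : E) ∈ signedCone g σ := by simp [signedCone]
  have hsmul : ∀ (c : ℝ), 0 ≤ c → ∀ y ∈ signedCone g σ, c • y ∈ signedCone g σ := by
    intro c hc y hy
    refine ⟨fun i => by rw [real_inner_smul_right, hy.1 i, mul_zero], fun k => ?_⟩
    rw [real_inner_smul_right]
    nlinarith [mul_nonpos_of_nonneg_of_nonpos hc (hy.2 k)]
  have hconv : Convex ℝ (signedCone g σ) := by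
    intro y hy z hz a b ha hb _
    refine ⟨fun i => ?_, fun k => ?_⟩
    · rw [inner_add_right, real_inner_smul_right, real_inner_smul_right, hy.1 i, hz.1 i]; simp
    · have h1 := (hsmul a ha y hy).2 k
      have h2 := (hsmul b hb z hz).2 k
      rw [inner_add_right, mul_add]
      linarith
  have hcl : IsClosed (signedCone g σ) := by
    have : signedCone g σ = (⋂ i, {y | ⟪g (Sum.inl i), y⟫_ℝ = 0}) ∩
        ⋂ k, {y | sgn (σ k) * ⟪g (Sum.inr k), y⟫_ℝ ≤ 0} := by
      ext y; simp [signedCone]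
    rw [this]
    exact (isClosed_iInter fun i => isClosed_eq (by fun_prop) continuous_const).inter
      (isClosed_iInter fun k => isClosed_le (by fun_prop) continuous_const)
  have : CompleteSpace E := FiniteDimensional.complete ℝ E
  obtain ⟨x, hx, hmin⟩ := exists_norm_eq_iInf_of_complete_convex ⟨0, h0⟩ hcl.isComplete hconv v
  have hle := (norm_eq_iInf_iff_real_inner_le_zero hconv hx).1 hmin
  have hx0 : ⟪v - x, x⟫_ℝ = 0 := by
    have h1 := hle 0 h0
    have h2 := hle ((2 : ℝ) • x) (hsmul 2 (by norm_num) x hx)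
    rw [two_smul, add_sub_cancel_right] at h2
    simp only [zero_sub, inner_neg_right] at h1
    linarith
  refine ⟨x, hx, hx0, fun y hy => ?_⟩
  have := hle y hy
  rw [inner_sub_right, hx0] at this
  linarith

/-- A direction that respects the constraints active at the projection does not increase the
linear functional `v - x`. -/
theorem IsConeProj.inner_le_of_active [Finite κ] {g : ι ⊕ κ → E} {σ : κ → ℤˣ} {v x y : E}
    (h : IsConeProj g σ v x) (hι : ∀ i, ⟪g (Sum.inl i), y⟫_ℝ = 0)
    (hκ : ∀ k, ⟪g (Sum.inr k), x⟫_ℝ = 0 → sgn (σ k) * ⟪g (Sum.inr k), y⟫_ℝ ≤ 0) :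
    ⟪v - x, y⟫_ℝ ≤ 0 := by
  -- A short step along `y` stays in the cone: active constraints are respected by `hκ`, inactive
  -- ones have slack.
  have hev : ∀ᶠ ε in 𝓝[>] (0 : ℝ), ∀ k, sgn (σ k) * ⟪g (Sum.inr k), x + ε • y⟫_ℝ ≤ 0 := by
    rw [eventually_all]
    intro k
    by_cases hk : ⟪g (Sum.inr k), x⟫_ℝ = 0
    · filter_upwards [self_mem_nhdsWithin] with ε hε
      rw [inner_add_right, hk, real_inner_smul_right]
      nlinarith [mul_nonpos_of_nonneg_of_nonpos (le_of_lt hε) (hκ k hk)]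
    · have hlt : sgn (σ k) * ⟪g (Sum.inr k), x⟫_ℝ < 0 := by
        refine lt_of_le_of_ne (h.mem.2 k) (mul_ne_zero ?_ hk)
        exact fun h0 => by simpa [h0] using sgn_mul_self (σ k)
      have hc : ContinuousAt (fun ε : ℝ => sgn (σ k) * ⟪g (Sum.inr k), x + ε • y⟫_ℝ) 0 := by
        fun_prop
      have := hc.eventually_lt (continuousAt_const (y := (0 : ℝ))) (by simpa using hlt)
      filter_upwards [nhdsWithin_le_nhds this] with ε hε using le_of_lt hε
  obtain ⟨ε, hε, hpos⟩ := (hev.and self_mem_nhdsWithin).exists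
  have := h.inner_le (x + ε • y)
    ⟨fun i => by rw [inner_add_right, real_inner_smul_right, h.mem.1, hι]; simp, hε⟩
  rw [inner_add_right, h.inner_self, zero_add, real_inner_smul_right] at this
  exact le_of_not_gt fun hlt => absurd this (not_le.2 (mul_pos hpos hlt))

variable [FiniteDimensional ℝ E] [Fintype ι] [DecidableEq ι] [DecidableEq κ]

/-- The residual of `v` with respect to all equality rows and the inequality rows in `S`. -/
def faceResid (g : ι ⊕ κ → E) (S : Finset κ) (v : E) : E :=
  resid g (Finset.univ.disjSum S) v

/-- The signs for which the face of the signed cone with active set `S` contains the projection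
of `v`. -/
def faceSigns (g : ι ⊕ κ → E) (v : E) (S : Finset κ) (k : κ) : ℤˣ :=
  if k ∈ S then
    signOf ⟪g (Sum.inr k), resid g ((Finset.univ.disjSum S).erase (Sum.inr k)) v⟫_ℝ
  else signOf (-⟪g (Sum.inr k), faceResid g S v⟫_ℝ)

/-- These are the optimality conditions: the signs off `S` make the residual feasible, and the signs
on `S` make every multiplier have the right sign. -/
theorem isConeProj_faceResid {g : ι ⊕ κ → E} {v : E} (hg : IsGeneric g v) {S : Finset κ}
    (hS : faceResid g S v ≠ 0) : IsConeProj g (faceSigns g v S) v (faceResid g S v) := by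
  have horth : ∀ r ∈ Finset.univ.disjSum S, ⟪g r, faceResid g S v⟫_ℝ = 0 :=
    fun r hr => inner_row_resid g v hr
  refine ⟨⟨fun i => horth _ (by simp), fun k => ?_⟩, inner_sub_resid_resid g _ v, ?_⟩
  · by_cases hk : k ∈ S
    · rw [horth _ (by simpa using hk), mul_zero]
    · rw [faceSigns, if_neg hk]
      linarith [sgn_signOf_mul_nonneg (-⟪g (Sum.inr k), faceResid g S v⟫_ℝ)]
  · intro y hy
    obtain ⟨c, hc⟩ := (Submodule.mem_span_image_finset_iff_exists_fun' ℝ).1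
      (sub_resid_mem_span g (Finset.univ.disjSum S) v)
    change ∑ r ∈ Finset.univ.disjSum S, c r • g r = v - faceResid g S v at hc
    rw [← hc, sum_inner]
    refine Finset.sum_nonpos fun r hr => ?_
    rw [real_inner_smul_left]
    rcases r with i | k
    · rw [hy.1 i, mul_zero]
    · have hk : k ∈ S := by simpa using hr
      have hyk := hy.2 k
      rw [faceSigns, if_pos hk] at hyk
      set a := ⟪g (Sum.inr k), resid g ((Finset.univ.disjSum S).erase (Sum.inr k)) v⟫_ℝ with ha
      have ha0 : a ≠ 0 := hg _ _ (Finset.notMem_erase _ _) (resid_erase_ne_zero _ hS)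
      have h1 := inner_sub_resid_erase (v := v) hr horth
      -- Pairing with the part of `g (inr k)` orthogonal to the other rows isolates the coefficient
      -- `c (inr k)`.
      rw [← hc, sum_inner, Finset.sum_eq_single_of_mem _ hr, real_inner_smul_left,
        inner_self_resid, ← ha] at h1
      · have hca : 0 ≤ sgn (signOf a) * c (Sum.inr k) := by
          have h2 : 0 ≤ sgn (signOf a) * c (Sum.inr k) *
              ‖resid g ((Finset.univ.disjSum S).erase (Sum.inr k)) (g (Sum.inr k))‖ ^ 2 := by
            rw [mul_assoc, h1]
            exact sgn_signOf_mul_nonneg a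
          refine nonneg_of_mul_nonneg_left h2 (lt_of_le_of_ne (sq_nonneg _) fun h0 => ha0 ?_)
          rw [← h1, ← h0, mul_zero]
        nlinarith [mul_nonpos_of_nonneg_of_nonpos hca hyk, sgn_mul_self (signOf a)]
      · intro t ht hne
        rw [real_inner_smul_left, inner_row_resid g _ (Finset.mem_erase.2 ⟨hne, ht⟩), mul_zero]

/-- The set of constraints active at `x` works; genericity then leaves no freedom in the signs. -/
theorem IsConeProj.exists_face [Fintype κ] {g : ι ⊕ κ → E} {v x : E} (hg : IsGeneric g v) {σ : κ → ℤˣ}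
    (h : IsConeProj g σ v x) (hx : x ≠ 0) :
    ∃ S, faceResid g S v = x ∧ faceSigns g v S = σ := by
  classical
  set S : Finset κ := Finset.univ.filter fun k => ⟪g (Sum.inr k), x⟫_ℝ = 0 with hSdef
  have hS : ∀ k, k ∈ S ↔ ⟪g (Sum.inr k), x⟫_ℝ = 0 := by simp [hSdef]
  have horth : ∀ r ∈ Finset.univ.disjSum S, ⟪g r, x⟫_ℝ = 0 := by
    rintro (i | k) hr
    · exact h.mem.1 i
    · exact (hS k).1 (by simpa using hr)
  have hres : faceResid g S v = x := by
    refine eq_resid horth ?_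
    -- If `y` is orthogonal to the active rows, both `y` and `-y` are admissible directions, so `v -
    -- x` is orthogonal to `y`.
    rw [← Submodule.orthogonal_orthogonal (Submodule.span ℝ _), Submodule.mem_orthogonal']
    intro y hy
    have hy' : ∀ r ∈ Finset.univ.disjSum S, ⟪g r, y⟫_ℝ = 0 := fun r hr =>
      (Submodule.mem_orthogonal _ _).1 hy _ (Submodule.subset_span ⟨r, hr, rfl⟩)
    have h1 := h.inner_le_of_active (y := y) (fun i => hy' _ (by simp)) fun k hk => by
      rw [hy' _ (by simpa using (hS k).2 hk), mul_zero]
    have h2 := h.inner_le_of_active (y := -y) (fun i => by simp [hy' (Sum.inl i) (by simp)])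
      fun k hk => by
        rw [inner_neg_right, hy' _ (by simpa using (hS k).2 hk), neg_zero, mul_zero]
    rw [inner_neg_right] at h2
    linarith
  refine ⟨S, hres, funext fun k => ?_⟩
  unfold faceSigns
  split_ifs with hk
  · have hmem : Sum.inr k ∈ (Finset.univ : Finset ι).disjSum S := by simpa using hk
    symm
    refine eq_signOf (hg _ _ (Finset.notMem_erase _ _)
      (resid_erase_ne_zero _ (hres.symm ▸ hx : faceResid g S v ≠ 0))) ?_
    rw [← inner_sub_resid_erase hmem horth]
    set w := resid g ((Finset.univ.disjSum S).erase (Sum.inr k)) (g (Sum.inr k)) with hw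
    have hwo : ∀ r ∈ Finset.univ.disjSum S, r ≠ Sum.inr k → ⟪g r, w⟫_ℝ = 0 :=
      fun r hr hne => inner_row_resid g _ (Finset.mem_erase.2 ⟨hne, hr⟩)
    -- This direction relaxes constraint `k` and leaves the other active constraints tight.
    have h1 := h.inner_le_of_active (y := -(sgn (σ k) • w))
      (fun i => by rw [inner_neg_right, real_inner_smul_right, hwo _ (by simp) (by simp)]; simp)
      fun l hl => by
        rw [inner_neg_right, real_inner_smul_right]
        rcases eq_or_ne l k with rfl | hne
        · have h2 : 0 ≤ ⟪g (Sum.inr l), w⟫_ℝ := by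
            rw [hw, inner_self_resid]; positivity
          nlinarith [sgn_mul_self (σ l)]
        · rw [hwo _ (by simpa using (hS l).2 hl) (by simpa using hne)]; simp
    rw [inner_neg_right, real_inner_smul_right] at h1
    linarith
  · symm
    rw [hres]
    refine eq_signOf (neg_ne_zero.2 fun h0 => hk ((hS k).2 h0)) ?_
    linarith [h.mem.2 k]

/-- Equal signs give the same cone, hence the same projection, and by genericity `S` is exactly the
active set there. -/
theorem faceSigns_injOn {g : ι ⊕ κ → E} {v : E} (hg : IsGeneric g v) :
    Set.InjOn (faceSigns g v) {S | faceResid g S v ≠ 0} := by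
  have key : ∀ S, faceResid g S v ≠ 0 →
      ∀ k, k ∈ S ↔ ⟪g (Sum.inr k), faceResid g S v⟫_ℝ = 0 := fun S hS k =>
    ⟨fun hk => inner_row_resid g v (by simpa using hk), fun h => by
      by_contra hk
      exact hg _ (Sum.inr k) (by simpa using hk) hS h⟩
  intro S hS S' hS' heq
  have h := isConeProj_faceResid hg hS
  rw [heq] at h
  ext k
  rw [key S hS, key S' hS', h.unique (isConeProj_faceResid hg hS')]

/-- For a generic family of rows the norms of the projections of `v` onto the cones of all sign
patterns are, with multiplicities, the norms of the residuals of `v` over all active sets. -/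
theorem card_filter_isConeProj [Fintype κ] {g : ι ⊕ κ → E} {v : E} (hg : IsGeneric g v)
    {f : (κ → ℤˣ) → E} (hf : ∀ σ, IsConeProj g σ v (f σ)) (p : ℝ → Prop) [DecidablePred p] :
    (Finset.univ.filter fun σ => p ‖f σ‖).card =
      (Finset.univ.filter fun S => p ‖faceResid g S v‖).card := by
  -- The bijection between faces and signs covers nonzero vectors only. If `p 0` holds, one counts
  -- the complement, since there are as many sign patterns as subsets.
  have aux : ∀ (p : ℝ → Prop) [DecidablePred p], ¬ p 0 →
      (Finset.univ.filter fun σ => p ‖f σ‖).card =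
        (Finset.univ.filter fun S => p ‖faceResid g S v‖).card := by
    intro p _ hp
    have hne : ∀ x : E, p ‖x‖ → x ≠ 0 := by
      rintro x hx rfl
      exact hp (by simpa using hx)
    symm
    refine Finset.card_bij (fun S _ => faceSigns g v S) ?_ ?_ ?_
    · intro S hS
      have hS' : p ‖faceResid g S v‖ := by simpa using hS
      have := (hf (faceSigns g v S)).unique (isConeProj_faceResid hg (hne _ hS'))
      simpa [this] using hS'
    · intro S hS S' hS' heq
      exact faceSigns_injOn hg (hne _ (by simpa using hS)) (hne _ (by simpa using hS')) heq
    · intro σ hσ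
      have hσ' : p ‖f σ‖ := by simpa using hσ
      obtain ⟨S, h1, h2⟩ := (hf σ).exists_face hg (hne _ hσ')
      exact ⟨S, by simpa [h1] using hσ', h2⟩
  by_cases hp : p 0
  · have h1 := aux (fun a => ¬ p a) (not_not.2 hp)
    have h2 := Finset.card_filter_add_card_filter_not (s := (Finset.univ : Finset (κ → ℤˣ)))
      (fun σ => p ‖f σ‖)
    have h3 := Finset.card_filter_add_card_filter_not (s := (Finset.univ : Finset (Finset κ)))
      (fun S => p ‖faceResid g S v‖)
    have h4 : (Finset.univ : Finset (κ → ℤˣ)).card = (Finset.univ : Finset (Finset κ)).card := by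
      simp [Finset.card_univ]
    omega
  · exact aux p hp

end Cone

end RandomLinearProgram

end

noncomputable section

namespace RandomLinearProgram

open scoped InnerProductSpace

/-! ### Second moments over sign vectors and subsets -/

section Moments

/-- Chebyshev's inequality for counting measure. -/
theorem card_filter_mul_sq_le {α : Type*} [Fintype α] (X : α → ℝ) {δ : ℝ} (hδ : 0 ≤ δ)
    [DecidablePred fun a => δ ≤ |X a|] :
    ((Finset.univ.filter fun a => δ ≤ |X a|).card : ℝ) * δ ^ 2 ≤ ∑ a, X a ^ 2 := by
  calc ((Finset.univ.filter fun a => δ ≤ |X a|).card : ℝ) * δ ^ 2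
      = ∑ a ∈ Finset.univ.filter (fun a => δ ≤ |X a|), δ ^ 2 := by
        rw [Finset.sum_const, nsmul_eq_mul]
    _ ≤ ∑ a ∈ Finset.univ.filter (fun a => δ ≤ |X a|), X a ^ 2 := by
        refine Finset.sum_le_sum fun a ha => ?_
        rw [← sq_abs (X a)]
        exact pow_le_pow_left₀ hδ (Finset.mem_filter.1 ha).2 2
    _ ≤ ∑ a, X a ^ 2 :=
        Finset.sum_le_sum_of_subset_of_nonneg (Finset.subset_univ _) fun _ _ _ => sq_nonneg _

/-- The variance of a binomial variable; the induction pairs `S` with `insert a S`. -/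
theorem sum_powerset_card_sub_half_sq {κ : Type*} [DecidableEq κ] (U : Finset κ) :
    ∑ S ∈ U.powerset, ((S.card : ℝ) - U.card / 2) ^ 2 =
      (2 : ℝ) ^ U.card * (U.card / 4) := by
  induction U using Finset.induction_on with
  | empty => simp
  | insert a U ha ih =>
    rw [Finset.sum_powerset_insert ha, ← Finset.sum_add_distrib, Finset.card_insert_of_notMem ha]
    have : ∀ S ∈ U.powerset, ((S.card : ℝ) - ((U.card + 1 : ℕ) : ℝ) / 2) ^ 2 +
        (((insert a S).card : ℝ) - ((U.card + 1 : ℕ) : ℝ) / 2) ^ 2 =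
        2 * ((S.card : ℝ) - U.card / 2) ^ 2 + 1 / 2 := by
      intro S hS
      rw [Finset.card_insert_of_notMem fun h => ha (Finset.mem_powerset.1 hS h)]
      push_cast
      ring
    rw [Finset.sum_congr rfl this, Finset.sum_add_distrib, ← Finset.mul_sum, ih, Finset.sum_const,
      Finset.card_powerset]
    simp only [nsmul_eq_mul]
    push_cast
    ring

variable {J : Type*} [DecidableEq J]

/-- The sign vector with a single negative entry. -/
def flipAt (j : J) : J → ℤˣ := Pi.mulSingle j (-1)

theorem sgn_mul_flipAt_self (s : J → ℤˣ) (j : J) :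
    sgn ((s * flipAt j) j) = -sgn (s j) := by
  simp [flipAt, sgn_neg]

theorem sgn_mul_flipAt_of_ne (s : J → ℤˣ) {i j : J} (h : i ≠ j) :
    sgn ((s * flipAt j) i) = sgn (s i) := by
  simp [flipAt, Pi.mulSingle_eq_of_ne h]

variable [Fintype J]

theorem sum_eq_zero_of_flip {f : (J → ℤˣ) → ℝ} (j : J)
    (h : ∀ s, f (s * flipAt j) = -f s) : ∑ s, f s = 0 := by
  have h1 : ∑ s, f (s * flipAt j) = ∑ s, f s :=
    Equiv.sum_comp (Equiv.mulRight (flipAt j)) f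
  simp only [h, Finset.sum_neg_distrib] at h1
  linarith

/-- Unless the two pairs coincide, some index occurs exactly once, and flipping its sign cancels the
sum. -/
theorem sum_four_sgn {i j k l : J} (hij : i ≠ j) (hkl : k ≠ l) :
    ∑ s : J → ℤˣ, sgn (s i) * sgn (s j) * (sgn (s k) * sgn (s l)) =
      2 ^ Fintype.card J * ((if i = k ∧ j = l then 1 else 0) + if i = l ∧ j = k then 1 else 0) := by
  have hone : ∀ s : J → ℤˣ, ∀ a b : J,
      sgn (s a) * sgn (s b) * (sgn (s a) * sgn (s b)) = 1 := fun s a b => by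
    rw [mul_mul_mul_comm, sgn_mul_self, sgn_mul_self, one_mul]
  by_cases h1 : i = k ∧ j = l
  · obtain ⟨rfl, rfl⟩ := h1
    simp [hone, hij]
  by_cases h2 : i = l ∧ j = k
  · obtain ⟨rfl, rfl⟩ := h2
    have : ∀ s : J → ℤˣ, sgn (s i) * sgn (s j) * (sgn (s j) * sgn (s i)) = 1 := fun s => by
      rw [mul_comm (sgn (s j)) (sgn (s i)), hone]
    simp [this, hij]
  rw [if_neg h1, if_neg h2, add_zero, mul_zero]
  by_cases hik : i = k
  · subst hik
    have hjl : l ≠ j := fun h => h1 ⟨rfl, h.symm⟩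
    refine sum_eq_zero_of_flip j fun s => ?_
    rw [sgn_mul_flipAt_self, sgn_mul_flipAt_of_ne s hij, sgn_mul_flipAt_of_ne s hjl]
    ring
  by_cases hil : i = l
  · subst hil
    have hjk : k ≠ j := fun h => h2 ⟨rfl, h.symm⟩
    refine sum_eq_zero_of_flip j fun s => ?_
    rw [sgn_mul_flipAt_self, sgn_mul_flipAt_of_ne s hij, sgn_mul_flipAt_of_ne s hjk]
    ring
  refine sum_eq_zero_of_flip i fun s => ?_
  rw [sgn_mul_flipAt_self, sgn_mul_flipAt_of_ne s hij.symm,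
    sgn_mul_flipAt_of_ne s (Ne.symm hik), sgn_mul_flipAt_of_ne s (Ne.symm hil)]
  ring

theorem sum_sq_quadratic_sgn_of_diag_zero {Q : J → J → ℝ} (hQ : ∀ i j, Q i j = Q j i)
    (h0 : ∀ i, Q i i = 0) :
    ∑ s : J → ℤˣ, (∑ i, ∑ j, Q i j * (sgn (s i) * sgn (s j))) ^ 2 =
      2 ^ Fintype.card J * (2 * ∑ i, ∑ j, Q i j ^ 2) := by
  have h1 : ∀ s : J → ℤˣ, (∑ i, ∑ j, Q i j * (sgn (s i) * sgn (s j))) ^ 2 =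
      ∑ p : J × J, ∑ q : J × J, Q p.1 p.2 * Q q.1 q.2 *
        (sgn (s p.1) * sgn (s p.2) * (sgn (s q.1) * sgn (s q.2))) := by
    intro s
    rw [sq, ← Fintype.sum_prod_type' (f := fun i j => Q i j * (sgn (s i) * sgn (s j))),
      Finset.sum_mul_sum]
    refine Finset.sum_congr rfl fun p _ => Finset.sum_congr rfl fun q _ => ?_
    ring
  simp only [h1]
  rw [Finset.sum_comm]
  have h2 : ∀ p : J × J, ∑ s : J → ℤˣ, ∑ q : J × J, Q p.1 p.2 * Q q.1 q.2 *
      (sgn (s p.1) * sgn (s p.2) * (sgn (s q.1) * sgn (s q.2))) =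
      2 ^ Fintype.card J * (2 * Q p.1 p.2 ^ 2) := by
    rintro ⟨i, j⟩
    rw [Finset.sum_comm]
    simp only [← Finset.mul_sum]
    by_cases hij : i = j
    · subst hij
      simp [h0]
    have h3 : ∀ q : J × J, Q i j * Q q.1 q.2 *
        ∑ s : J → ℤˣ, sgn (s i) * sgn (s j) * (sgn (s q.1) * sgn (s q.2)) =
        2 ^ Fintype.card J * ((if q = (i, j) then Q i j * Q q.1 q.2 else 0) +
          if q = (j, i) then Q i j * Q q.1 q.2 else 0) := by
      rintro ⟨k, l⟩
      by_cases hkl : k = l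
      · subst hkl
        simp [h0]
      · rw [sum_four_sgn hij hkl]
        simp only [Prod.mk.injEq, eq_comm (a := k), eq_comm (a := l), and_comm (a := j = k)]
        split_ifs <;> ring
    simp only [h3]
    rw [← Finset.mul_sum, Finset.sum_add_distrib, Finset.sum_ite_eq', Finset.sum_ite_eq']
    simp only [Finset.mem_univ, if_true, hQ j i]
    ring
  simp only [h2, ← Finset.mul_sum]
  rw [Fintype.sum_prod_type]

/-- Since signs square to one, the diagonal contributes precisely the trace, and only the
off-diagonal form fluctuates. -/
theorem sum_sq_quadratic_sgn_sub_trace_le {Q : J → J → ℝ} (hQ : ∀ i j, Q i j = Q j i) :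
    ∑ s : J → ℤˣ, (∑ i, ∑ j, Q i j * (sgn (s i) * sgn (s j)) - ∑ i, Q i i) ^ 2 ≤
      2 ^ Fintype.card J * (2 * ∑ i, ∑ j, Q i j ^ 2) := by
  set Q' : J → J → ℝ := fun i j => if i = j then 0 else Q i j with hQ'
  have h1 : ∀ s : J → ℤˣ, ∑ i, ∑ j, Q i j * (sgn (s i) * sgn (s j)) - ∑ i, Q i i =
      ∑ i, ∑ j, Q' i j * (sgn (s i) * sgn (s j)) := by
    intro s
    rw [← Finset.sum_sub_distrib]
    refine Finset.sum_congr rfl fun i _ => ?_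
    rw [sub_eq_iff_eq_add, ← Finset.sum_erase_add _ _ (Finset.mem_univ i), sgn_mul_self, mul_one,
      ← Finset.sum_erase_add (f := fun j => Q' i j * _) _ (Finset.mem_univ i)]
    simp only [hQ', if_true, zero_mul, add_zero, add_left_inj]
    exact Finset.sum_congr rfl fun j hj => by rw [if_neg (Finset.ne_of_mem_erase hj).symm]
  simp only [h1]
  rw [sum_sq_quadratic_sgn_of_diag_zero (Q := Q') (fun i j => by simp [hQ', hQ i j, eq_comm])
    (by simp [hQ'])]
  have h2 : ∀ i j, Q' i j ^ 2 ≤ Q i j ^ 2 := fun i j => by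
    simp only [hQ']
    split_ifs
    · rw [zero_pow two_ne_zero]
      exact sq_nonneg _
    · exact le_rfl
  exact mul_le_mul_of_nonneg_left (mul_le_mul_of_nonneg_left
    (Finset.sum_le_sum fun i _ => Finset.sum_le_sum fun j _ => h2 i j) zero_le_two) (by positivity)

/-- The vector in Euclidean space with the given signs as coordinates. -/
def signVec (s : J → ℤˣ) : EuclideanSpace ℝ J := WithLp.toLp 2 fun j => sgn (s j)

theorem signVec_eq_sum (s : J → ℤˣ) :
    signVec s = ∑ j, sgn (s j) • EuclideanSpace.basisFun J ℝ j := by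
  have := (EuclideanSpace.basisFun J ℝ).sum_repr (signVec s)
  rw [← this]
  simp [signVec]

/-- The squared length of the projection of a random sign vector onto a subspace concentrates
around the dimension of the subspace. -/
theorem sum_sq_norm_starProjection_signVec_sub_finrank_le
    (W : Submodule ℝ (EuclideanSpace ℝ J)) :
    ∑ s : J → ℤˣ, (‖W.starProjection (signVec s)‖ ^ 2 - Module.finrank ℝ W) ^ 2 ≤
      2 ^ Fintype.card J * (2 * Fintype.card J) := by
  set b := EuclideanSpace.basisFun J ℝ with hb
  set Q : J → J → ℝ := fun i j => ⟪b i, W.starProjection (b j)⟫_ℝ with hQ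
  have hsymm : ∀ i j, Q i j = Q j i := fun i j => by
    simp only [hQ]
    rw [← Submodule.inner_starProjection_left_eq_right, real_inner_comm]
  have hnorm : ∀ x, ‖W.starProjection x‖ ^ 2 = ⟪x, W.starProjection x⟫_ℝ := fun x => by
    have := W.re_inner_starProjection_eq_normSq x
    rw [← Submodule.inner_starProjection_left_eq_right]
    simpa using this.symm
  have hquad : ∀ s : J → ℤˣ, ‖W.starProjection (signVec s)‖ ^ 2 =
      ∑ i, ∑ j, Q i j * (sgn (s i) * sgn (s j)) := by
    intro s
    rw [hnorm, signVec_eq_sum, map_sum, sum_inner]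
    refine Finset.sum_congr rfl fun i _ => ?_
    rw [inner_sum]
    refine Finset.sum_congr rfl fun j _ => ?_
    rw [map_smul, real_inner_smul_left, real_inner_smul_right]
    ring
  have htrace : ∑ i, Q i i = Module.finrank ℝ W := by
    have h1 : LinearMap.IsProj W (W.starProjection : EuclideanSpace ℝ J →ₗ[ℝ] _) :=
      ⟨fun x => W.starProjection_apply_mem x, fun x hx => Submodule.starProjection_eq_self_iff.2 hx⟩
    rw [← h1.trace, LinearMap.trace_eq_sum_inner _ b]
    rfl
  -- For an orthogonal projection the squared Frobenius norm equals the trace, which is the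
  -- dimension.
  have hsq : ∑ i, ∑ j, Q i j ^ 2 = Module.finrank ℝ W := by
    rw [← htrace, Finset.sum_comm]
    refine Finset.sum_congr rfl fun j _ => ?_
    have := b.sum_sq_norm_inner_right (W.starProjection (b j))
    simp only [Real.norm_eq_abs, sq_abs] at this
    rw [this, hnorm]
  have hle : (Module.finrank ℝ W : ℝ) ≤ Fintype.card J := by
    have := W.finrank_le
    rw [finrank_euclideanSpace] at this
    exact_mod_cast this
  simp only [hquad]
  rw [← htrace]
  refine (sum_sq_quadratic_sgn_sub_trace_le hsymm).trans ?_
  rw [hsq]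
  gcongr

/-- Half the difference of two sign vectors differing in one entry is, up to sign, a basis vector.
-/
theorem eq_top_of_signVec_mem {U : Submodule ℝ (EuclideanSpace ℝ J)}
    (h : ∀ s : J → ℤˣ, signVec s ∈ U) : U = ⊤ := by
  rw [eq_top_iff, ← (EuclideanSpace.basisFun J ℝ).toBasis.span_eq, Submodule.span_le]
  rintro _ ⟨j, rfl⟩
  have h1 : (EuclideanSpace.basisFun J ℝ).toBasis j =
      (2⁻¹ : ℝ) • (signVec 1 - signVec (1 * flipAt j)) := by
    ext i
    rcases eq_or_ne i j with rfl | hij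
    · simp [signVec, flipAt, sgn_one, sgn_neg]
      norm_num
    · simp [signVec, flipAt, sgn_one, hij]
  rw [h1]
  exact U.smul_mem _ (U.sub_mem (h _) (h _))

variable {R : Type*}

/-- Rows that are generic for all sign vectors are in general position. -/
theorem finrank_orthogonal_span_of_isGeneric {g : R → EuclideanSpace ℝ J}
    (hg : ∀ s : J → ℤˣ, IsGeneric g (signVec s)) (T : Finset R) :
    Module.finrank ℝ (Submodule.span ℝ (g '' T))ᗮ = Fintype.card J - T.card := by
  classical
  have key : Submodule.span ℝ (g '' T) = ⊤ ∨
      Module.finrank ℝ (Submodule.span ℝ (g '' T)) = T.card := by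
    induction T using Finset.induction_on with
    | empty => right; simp
    | insert r T hr ih =>
      have hins : Submodule.span ℝ (g '' ↑(insert r T)) =
          Submodule.span ℝ (g '' T) ⊔ Submodule.span ℝ {g r} := by
        rw [Finset.coe_insert, Set.image_insert_eq, Submodule.span_insert, sup_comm]
      rw [hins]
      by_cases htop : Submodule.span ℝ (g '' T) = ⊤
      · left; rw [htop, top_sup_eq]
      right
      obtain ⟨s, hs⟩ : ∃ s : J → ℤˣ, signVec s ∉ Submodule.span ℝ (g '' T) := by
        by_contra! hcon
        exact htop (eq_top_of_signVec_mem hcon)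
      have hres : resid g T (signVec s) ≠ 0 := by
        intro h0
        have := sub_resid_mem_span g T (signVec s)
        rw [h0, sub_zero] at this
        exact hs this
      -- A row inside the span would be orthogonal to the nonzero residual of `signVec s`, against
      -- genericity.
      have hnot : g r ∉ Submodule.span ℝ (g '' T) := fun hmem =>
        hg s T r hr hres ((Submodule.mem_orthogonal _ _).1
          (Submodule.starProjection_apply_mem _ (signVec s)) _ hmem)
      rw [Submodule.finrank_sup_span_singleton hnot, Finset.card_insert_of_notMem hr,
        ih.resolve_left htop]
  have hadd := Submodule.finrank_add_finrank_orthogonal (Submodule.span ℝ (g '' (T : Set R)))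
  rw [finrank_euclideanSpace] at hadd
  rcases key with h | h
  -- When the rows span everything there are at least `card J` of them, so the truncated difference
  -- is zero.
  · have hle : Module.finrank ℝ (Submodule.span ℝ (g '' (T : Set R))) ≤ T.card := by
      have := finrank_span_finset_le_card (R := ℝ) (T.image g)
      rw [Finset.coe_image] at this
      exact this.trans Finset.card_image_le
    rw [h, finrank_top, finrank_euclideanSpace] at hle hadd
    rw [h]
    omega
  · omega

end Moments

end RandomLinearProgram

end

noncomputable section

namespace RandomLinearProgram

open scoped InnerProductSpace ENNReal

/-! ### Null sets and averaging over measure-preserving maps -/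

section Measure

theorem isClosed_setOf_exists_mem_compact {X Y : Type*} [TopologicalSpace X] [TopologicalSpace Y]
    {K : Set Y} (hK : IsCompact K) {Z : Set (X × Y)} (hZ : IsClosed Z) :
    IsClosed {x | ∃ y ∈ K, (x, y) ∈ Z} := by
  have : CompactSpace K := isCompact_iff_compactSpace.1 hK
  have h := isClosedMap_fst_of_compactSpace (X := X) (Y := K) _
    (hZ.preimage (f := fun p : X × K => (p.1, (p.2 : Y))) (by fun_prop))
  convert h using 1
  ext x
  simp

/-- A measurable set that meets every line parallel to one coordinate axis in at most one point
is null for a product of atomless measures. -/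
theorem measure_pi_eq_zero_of_subsingleton_line {I : Type*} [Fintype I] [DecidableEq I]
    (μ : I → Measure ℝ) [∀ i, SigmaFinite (μ i)] (i : I) [NullSingletonClass (μ i)]
    {B : Set (I → ℝ)} (hB : MeasurableSet B)
    (h : ∀ x, {t | Function.update x i t ∈ B}.Subsingleton) : Measure.pi μ B = 0 := by
  rw [← lintegral_indicator_one hB, lintegral_eq_lmarginal_univ 0,
    lmarginal_erase' _ (measurable_one.indicator hB) (Finset.mem_univ i)]
  have h0 : (fun x => ∫⁻ t, B.indicator (1 : (I → ℝ) → ℝ≥0∞) (Function.update x i t) ∂μ i) =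
      fun _ => 0 := by
    funext x
    have hm : MeasurableSet {t | Function.update x i t ∈ B} := measurable_update x hB
    have : (fun t => B.indicator (1 : (I → ℝ) → ℝ≥0∞) (Function.update x i t)) =
        {t | Function.update x i t ∈ B}.indicator 1 := rfl
    rw [this, lintegral_indicator_one hm, (h x).measure_zero]
  rw [h0]
  simp [lmarginal]

/-- Each `Φ a` preserves `γ`, so `γ T` is the mean proportion of the `a` that send `x` into `T`; a
pointwise count bounds it. -/
theorem card_mul_measure_le {α X : Type*} [Fintype α] [MeasurableSpace X] {γ : Measure X}
    [IsProbabilityMeasure γ] {Φ : α → X → X} (hΦ : ∀ a, MeasurePreserving (Φ a) γ γ) {T : Set X}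
    (hT : MeasurableSet T) [∀ x, DecidablePred fun a => Φ a x ∈ T] {C : ℝ≥0∞}
    (h : ∀ᵐ x ∂γ, ((Finset.univ.filter fun a => Φ a x ∈ T).card : ℝ≥0∞) ≤ C) :
    (Fintype.card α : ℝ≥0∞) * γ T ≤ C := by
  have h1 : ∀ x, ((Finset.univ.filter fun a => Φ a x ∈ T).card : ℝ≥0∞) =
      ∑ a, T.indicator (1 : X → ℝ≥0∞) (Φ a x) := by
    intro x
    simp [Set.indicator_apply, Finset.sum_boole]
  calc (Fintype.card α : ℝ≥0∞) * γ T = ∑ a : α, ∫⁻ x, T.indicator 1 (Φ a x) ∂γ := by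
        simp [(hΦ _).lintegral_comp (measurable_one.indicator hT), lintegral_indicator_one hT]
    _ = ∫⁻ x, ∑ a, T.indicator 1 (Φ a x) ∂γ :=
        (lintegral_finsetSum _ fun a _ =>
          (measurable_one.indicator hT).comp (hΦ a).measurable).symm
    _ ≤ ∫⁻ _, C ∂γ := lintegral_mono_ae (h.mono fun x hx => (h1 x) ▸ hx)
    _ = C := by simp

end Measure

/-! ### Generic position of Gaussian rows -/

section Gaussian

variable {R J : Type*}

/-- The rows of an array of numbers, as vectors of Euclidean space. -/
def rowVec (G : R × J → ℝ) (r : R) : EuclideanSpace ℝ J := WithLp.toLp 2 fun j => G (r, j)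

/-- The law of an array of independent standard normal variables. -/
def stdGaussianArray (I : Type*) [Fintype I] : Measure (I → ℝ) :=
  Measure.pi fun _ => gaussianReal 0 1

instance (I : Type*) [Fintype I] : IsProbabilityMeasure (stdGaussianArray I) := by
  unfold stdGaussianArray
  infer_instance

@[fun_prop]
theorem continuous_rowVec (r : R) : Continuous fun G : R × J → ℝ => rowVec G r := by
  unfold rowVec
  fun_prop

variable [Fintype J]

theorem inner_rowVec (G : R × J → ℝ) (r : R) (x : EuclideanSpace ℝ J) :
    ⟪rowVec G r, x⟫_ℝ = ∑ j, G (r, j) * x j := by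
  simp [rowVec, PiLp.inner_apply, mul_comm]

variable [Fintype R]

/-- Arrays for which row `r` is orthogonal to the residual of `v` with respect to `T`, while the
`j`-th coordinate of that residual is nonzero. -/
def degenerateArrays (T : Finset R) (r : R) (j : J) (v : EuclideanSpace ℝ J) :
    Set (R × J → ℝ) :=
  {G | resid (rowVec G) T v j ≠ 0 ∧ ⟪rowVec G r, resid (rowVec G) T v⟫_ℝ = 0}

/-- The residual need not be continuous in `G`, but it is characterised by closed conditions on a
pair (residual, coefficients). Bounding that pair and `1 / |x j|` by `N` gives closed projections
along compact balls, whose countable union is the set. -/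
theorem measurableSet_degenerateArrays (T : Finset R) (r : R) (j : J)
    (v : EuclideanSpace ℝ J) : MeasurableSet (degenerateArrays T r j v) := by
  let Z : ℕ → Set ((R × J → ℝ) × (EuclideanSpace ℝ J × (R → ℝ))) := fun N =>
    {p | p.2.1 + ∑ t ∈ T, p.2.2 t • rowVec p.1 t = v} ∩
      ((⋂ t ∈ T, {p | ⟪rowVec p.1 t, p.2.1⟫_ℝ = 0}) ∩
        ({p | ⟪rowVec p.1 r, p.2.1⟫_ℝ = 0} ∩ {p | 1 ≤ N * |p.2.1 j|}))
  have hrow : ∀ t, Continuous fun p : (R × J → ℝ) × (EuclideanSpace ℝ J × (R → ℝ)) =>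
      rowVec p.1 t := fun t => (continuous_rowVec t).comp continuous_fst
  have hZ : ∀ N, IsClosed (Z N) := fun N => by
    refine (isClosed_eq ?_ continuous_const).inter ((isClosed_biInter fun t _ =>
      isClosed_eq ?_ continuous_const).inter ((isClosed_eq ?_ continuous_const).inter
        (isClosed_le continuous_const ?_)))
    · exact continuous_snd.fst.add (continuous_finsetSum _ fun t _ =>
        ((continuous_apply t).comp continuous_snd.snd).smul (hrow t))
    · exact (hrow t).inner continuous_snd.fst
    · exact (hrow r).inner continuous_snd.fst
    · fun_prop
  have heq : degenerateArrays T r j v =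
      ⋃ N : ℕ, {G | ∃ y ∈ Metric.closedBall (0 : EuclideanSpace ℝ J × (R → ℝ)) N,
        (G, y) ∈ Z N} := by
    ext G
    simp only [degenerateArrays, Set.mem_ofPred_eq, Set.mem_iUnion]
    constructor
    · rintro ⟨h1, h2⟩
      obtain ⟨c, hc⟩ := (Submodule.mem_span_image_finset_iff_exists_fun' ℝ).1
        (sub_resid_mem_span (rowVec G) T v)
      obtain ⟨N, hN⟩ := exists_nat_ge
        (max ‖(resid (rowVec G) T v, c)‖ (1 / |resid (rowVec G) T v j|))
      refine ⟨N, (resid (rowVec G) T v, c), ?_, ?_, ?_, h2, ?_⟩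
      · simpa using (le_max_left _ _).trans hN
      · simp [hc]
      · simp only [Set.mem_iInter]
        exact fun t ht => inner_row_resid _ _ ht
      · have := (le_max_right _ _).trans hN
        rwa [div_le_iff₀ (abs_pos.2 h1)] at this
    · rintro ⟨N, ⟨x, c⟩, -, hv, ho, hr, hj⟩
      simp only [Set.mem_iInter] at ho
      have hx : resid (rowVec G) T v = x := by
        refine eq_resid ho ((Submodule.mem_span_image_finset_iff_exists_fun' ℝ).2 ⟨c, ?_⟩)
        exact eq_sub_of_add_eq' hv
      rw [hx]
      refine ⟨fun h0 => ?_, hr⟩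
      have hj' : (1 : ℝ) ≤ N * |x j| := hj
      norm_num [h0] at hj'
  rw [heq]
  exact MeasurableSet.iUnion fun N =>
    (isClosed_setOf_exists_mem_compact (isCompact_closedBall _ _) (hZ N)).measurableSet

/-- The residual ignores row `r`, so the inner product is affine in the entry `(r, j)` with nonzero
slope and has at most one root. -/
theorem measure_degenerateArrays [DecidableEq R] [DecidableEq J] {T : Finset R} {r : R}
    (hr : r ∉ T) (j : J) (v : EuclideanSpace ℝ J) :
    stdGaussianArray (R × J) (degenerateArrays T r j v) = 0 := by
  have : NullSingletonClass (gaussianReal 0 1) := nullSingletonClass_gaussianReal one_ne_zero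
  refine measure_pi_eq_zero_of_subsingleton_line _ (r, j)
    (measurableSet_degenerateArrays T r j v) fun G => ?_
  have hres : ∀ t, resid (rowVec (Function.update G (r, j) t)) T v = resid (rowVec G) T v := by
    intro t
    have : rowVec (Function.update G (r, j) t) '' T = rowVec G '' T := by
      refine Set.image_congr fun q hq => ?_
      have hne : q ≠ r := fun h => hr (h ▸ hq)
      simp [rowVec, hne]
    simp [resid, this]
  have hinner : ∀ t, ⟪rowVec (Function.update G (r, j) t) r, resid (rowVec G) T v⟫_ℝ =
      t * resid (rowVec G) T v j +
        ∑ i ∈ Finset.univ.erase j, G (r, i) * resid (rowVec G) T v i := by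
    intro t
    rw [inner_rowVec, ← Finset.add_sum_erase _ _ (Finset.mem_univ j)]
    congr 1
    · simp
    · refine Finset.sum_congr rfl fun i hi => ?_
      rw [Function.update_of_ne]
      simpa using Finset.ne_of_mem_erase hi
  intro t ht t' ht'
  simp only [degenerateArrays, Set.mem_ofPred_eq, hres, hinner] at ht ht'
  refine mul_right_cancel₀ ht.1 ?_
  linarith [ht.2, ht'.2]

theorem ae_isGeneric (v : EuclideanSpace ℝ J) :
    ∀ᵐ G ∂stdGaussianArray (R × J), IsGeneric (rowVec G) v := by
  classical
  have h : ∀ᵐ G ∂stdGaussianArray (R × J), ∀ (T : Finset R) (r : R) (j : J), r ∉ T →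
      G ∉ degenerateArrays T r j v := by
    simp only [ae_all_iff]
    intro T r j hr
    exact measure_eq_zero_iff_ae_notMem.1 (measure_degenerateArrays hr j v)
  filter_upwards [h] with G hG T r hr hne h0
  obtain ⟨j, hj⟩ : ∃ j, resid (rowVec G) T v j ≠ 0 := by
    by_contra! hcon
    exact hne (by ext j; simpa using hcon j)
  exact hG T r j hr ⟨hj, h0⟩

theorem measurePreserving_sgn_mul {I : Type*} [Fintype I] (c : I → ℤˣ) :
    MeasurePreserving (fun (G : I → ℝ) i => sgn (c i) * G i) (stdGaussianArray I)
      (stdGaussianArray I) := by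
  refine measurePreserving_pi _ _ fun i => ⟨by fun_prop, ?_⟩
  refine (gaussianReal_map_const_mul (sgn (c i))).trans ?_
  rw [mul_zero, mul_one]
  congr 1
  ext
  exact (sq (sgn (c i))).trans (sgn_mul_self _)

end Gaussian

/-! ### The random linear program under sign flips -/

section Program

variable {m₁ m₂ n : ℕ}

/-- The optimal value of the linear program with constraint rows stored in the array `G`. -/
def arrayValue (G : (Fin m₁ ⊕ Fin m₂) × Fin n → ℝ) : ℝ :=
  xiH fLp (Matrix.of fun i j => G (Sum.inl i, j)) (Matrix.of fun k j => G (Sum.inr k, j))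

/-- The minimum is attained, so each sublevel set is the projection of a closed set along the
compact unit ball. -/
theorem measurable_arrayValue :
    Measurable (arrayValue : ((Fin m₁ ⊕ Fin m₂) × Fin n → ℝ) → ℝ) := by
  refine measurable_of_Iic fun a => IsClosed.measurableSet ?_
  let Z : Set (((Fin m₁ ⊕ Fin m₂) × Fin n → ℝ) × EuclideanSpace ℝ (Fin n)) :=
    (⋂ i, {p | ⟪rowVec p.1 (Sum.inl i), p.2⟫_ℝ = 0}) ∩
      ((⋂ k, {p | ⟪rowVec p.1 (Sum.inr k), p.2⟫_ℝ ≤ 0}) ∩ {p | fLp p.2 ≤ a})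
  have hrow : ∀ r, Continuous fun p : ((Fin m₁ ⊕ Fin m₂) × Fin n → ℝ) ×
      EuclideanSpace ℝ (Fin n) => rowVec p.1 r := fun r =>
    (continuous_rowVec r).comp continuous_fst
  have hZ : IsClosed Z := by
    refine (isClosed_iInter fun i => isClosed_eq ?_ continuous_const).inter
      ((isClosed_iInter fun k => isClosed_le ?_ continuous_const).inter
        (isClosed_le ?_ continuous_const))
    · exact (hrow _).inner continuous_snd
    · exact (hrow _).inner continuous_snd
    · unfold fLp
      fun_prop
  convert isClosed_setOf_exists_mem_compact
    (isCompact_closedBall (0 : EuclideanSpace ℝ (Fin n)) 1) hZ using 1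
  ext G
  have hmem : ∀ y, (y ∈ feasible (Matrix.of fun i j => G (Sum.inl i, j))
      (Matrix.of fun k j => G (Sum.inr k, j)) ∧ fLp y ≤ a) ↔
      y ∈ Metric.closedBall (0 : EuclideanSpace ℝ (Fin n)) 1 ∧ (G, y) ∈ Z := by
    intro y
    simp only [feasible, Set.mem_ofPred_eq, Z, Set.mem_inter_iff, Set.mem_iInter, inner_rowVec,
      Metric.mem_closedBall, dist_zero_right, funext_iff, Matrix.mulVec, dotProduct, Matrix.of_apply,
      Pi.zero_apply]
    tauto
  have hleast := isLeast_xiH (Matrix.of fun i j => G (Sum.inl i, j))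
    (Matrix.of fun k j => G (Sum.inr k, j))
  simp only [Set.mem_preimage, Set.mem_Iic, Set.mem_ofPred_eq, ← hmem]
  constructor
  · intro h
    obtain ⟨y, hy, hval⟩ := hleast.1
    exact ⟨y, hy, hval.le.trans h⟩
  · rintro ⟨y, hy, hval⟩
    exact (hleast.2 ⟨y, hy, rfl⟩).trans hval

/-- Flip the signs of the inequality rows by `σ` and of the columns by `-s`. -/
def flipArray (σ : Fin m₂ → ℤˣ) (s : Fin n → ℤˣ) (G : (Fin m₁ ⊕ Fin m₂) × Fin n → ℝ)
    (p : (Fin m₁ ⊕ Fin m₂) × Fin n) : ℝ :=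
  sgn (Sum.elim (fun _ => 1) σ p.1 * -s p.2) * G p

/-- On the cone `⟪v, y⟫ ≤ ⟪x, y⟫ ≤ ‖x‖ ‖y‖`, where `v` is the sign vector and `x` its projection;
equality holds at `x / ‖x‖`. The involution `D` carries the flipped program to this one. -/
theorem arrayValue_flipArray {G : (Fin m₁ ⊕ Fin m₂) × Fin n → ℝ} {σ : Fin m₂ → ℤˣ}
    {s : Fin n → ℤˣ} {x : EuclideanSpace ℝ (Fin n)}
    (hx : IsConeProj (rowVec G) σ (signVec s) x) : arrayValue (flipArray σ s G) = -‖x‖ := by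
  let D : EuclideanSpace ℝ (Fin n) → EuclideanSpace ℝ (Fin n) := fun y =>
    WithLp.toLp 2 fun j => -sgn (s j) * y j
  have hDD : ∀ y, D (D y) = y := fun y => by
    ext j
    simp only [D]
    rw [← mul_assoc, neg_mul_neg, sgn_mul_self, one_mul]
  have hDn : ∀ y, ‖D y‖ = ‖y‖ := fun y => by
    rw [EuclideanSpace.norm_eq, EuclideanSpace.norm_eq]
    congr 1
    refine Finset.sum_congr rfl fun j _ => ?_
    simp only [D, Real.norm_eq_abs, sq_abs]
    rw [mul_pow, neg_sq, sq (sgn _), sgn_mul_self, one_mul]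
  have hval : ∀ y, fLp y = -⟪signVec s, D y⟫_ℝ := fun y => by
    simp only [fLp, signVec, D, PiLp.inner_apply, ← Finset.sum_neg_distrib]
    refine Finset.sum_congr rfl fun j _ => ?_
    simp only [RCLike.inner_apply, conj_trivial]
    linear_combination -(y j) * sgn_mul_self (s j)
  have hfeas : ∀ y, y ∈ feasible (Matrix.of fun i j => flipArray σ s G (Sum.inl i, j))
      (Matrix.of fun k j => flipArray σ s G (Sum.inr k, j)) ↔
      D y ∈ signedCone (rowVec G) σ ∧ ‖D y‖ ≤ 1 := by
    intro y
    have h1 : ∀ i, (∑ j, flipArray σ s G (Sum.inl i, j) * y j) =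
        ∑ j, G (Sum.inl i, j) * D y j := fun i => by
      refine Finset.sum_congr rfl fun j _ => ?_
      simp only [flipArray, D, Sum.elim_inl, one_mul, sgn_neg]
      ring
    have h2 : ∀ k, (∑ j, flipArray σ s G (Sum.inr k, j) * y j) =
        sgn (σ k) * ∑ j, G (Sum.inr k, j) * D y j := fun k => by
      rw [Finset.mul_sum]
      refine Finset.sum_congr rfl fun j _ => ?_
      simp only [flipArray, D, Sum.elim_inr, sgn_mul, sgn_neg]
      ring
    simp only [feasible, signedCone, Set.mem_ofPred_eq, inner_rowVec, hDn, funext_iff,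
      Matrix.mulVec, dotProduct, Matrix.of_apply, Pi.zero_apply, h1, h2, and_assoc]
  refine (isLeast_xiH _ _).unique ⟨?_, ?_⟩
  · rcases eq_or_ne x 0 with rfl | hx0
    · exact ⟨0, by simp [feasible], by simp [fLp]⟩
    · have hpos : 0 < ‖x‖ := norm_pos_iff.2 hx0
      refine ⟨D (‖x‖⁻¹ • x), (hfeas _).2 ?_, ?_⟩
      · rw [hDD]
        refine ⟨⟨fun i => by rw [real_inner_smul_right, hx.mem.1, mul_zero], fun k => ?_⟩, ?_⟩
        · rw [real_inner_smul_right, mul_left_comm]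
          exact mul_nonpos_of_nonneg_of_nonpos (by positivity) (hx.mem.2 k)
        · rw [norm_smul, norm_inv, norm_norm, inv_mul_cancel₀ hpos.ne']
      · have h1 := hx.inner_self
        rw [inner_sub_left, real_inner_self_eq_norm_sq, sub_eq_zero] at h1
        rw [hval, hDD, real_inner_smul_right, h1]
        field_simp
  · rintro _ ⟨y, hy, rfl⟩
    obtain ⟨hmem, hle⟩ := (hfeas y).1 hy
    have h1 := hx.inner_le _ hmem
    have h2 := real_inner_le_norm x (D y)
    rw [inner_sub_left] at h1
    rw [hval]
    nlinarith [norm_nonneg x]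

theorem card_filter_arrayValue {G : (Fin m₁ ⊕ Fin m₂) × Fin n → ℝ}
    (hG : ∀ s : Fin n → ℤˣ, IsGeneric (rowVec G) (signVec s)) (p : ℝ → Prop) [DecidablePred p] :
    (Finset.univ.filter fun a : (Fin m₂ → ℤˣ) × (Fin n → ℤˣ) =>
        p (-arrayValue (flipArray a.1 a.2 G))).card =
      (Finset.univ.filter fun a : Finset (Fin m₂) × (Fin n → ℤˣ) =>
        p ‖faceResid (rowVec G) a.1 (signVec a.2)‖).card := by
  choose f hf using fun (s : Fin n → ℤˣ) (σ : Fin m₂ → ℤˣ) =>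
    exists_isConeProj (rowVec G) σ (signVec s)
  have h1 : ∀ a : (Fin m₂ → ℤˣ) × (Fin n → ℤˣ),
      -arrayValue (flipArray a.1 a.2 G) = ‖f a.2 a.1‖ := fun a => by
    rw [arrayValue_flipArray (hf a.2 a.1), neg_neg]
  simp only [h1, Finset.card_filter, Fintype.sum_prod_type_right]
  simp only [← Finset.card_filter]
  exact Finset.sum_congr rfl fun s _ => card_filter_isConeProj (hG s) (hf s) p

end Program

end RandomLinearProgram

end

noncomputable section

namespace RandomLinearProgram

open scoped InnerProductSpace ENNReal

/-! ### Tail bounds for the optimal value -/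

section Tail

variable {m₁ m₂ n : ℕ}

open Classical in
theorem card_filter_card_sub_half_le {δ : ℝ} (hδ : 0 < δ) :
    ((Finset.univ.filter fun a : Finset (Fin m₂) × (Fin n → ℤˣ) =>
        δ ≤ |(a.1.card : ℝ) - m₂ / 2|).card : ℝ) ≤ 2 ^ (m₂ + n) * ((m₂ / 4) / δ ^ 2) := by
  have h := card_filter_mul_sq_le
    (fun a : Finset (Fin m₂) × (Fin n → ℤˣ) => (a.1.card : ℝ) - m₂ / 2) hδ.le
  have h1 := sum_powerset_card_sub_half_sq (Finset.univ : Finset (Fin m₂))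
  rw [Finset.powerset_univ, Finset.card_fin] at h1
  rw [Fintype.sum_prod_type_right] at h
  simp only [h1, Finset.sum_const] at h
  have hcard : (Finset.univ : Finset (Fin n → ℤˣ)).card = 2 ^ n := by simp
  rw [hcard, nsmul_eq_mul] at h
  rw [← mul_div_assoc, le_div_iff₀ (by positivity)]
  refine h.trans (le_of_eq ?_)
  push_cast
  ring

open Classical in
-- For each fixed `S` the subspace is fixed, and its dimension is known by general position, so the
-- second-moment bound over `s` applies.
theorem card_filter_norm_faceResid_sub_le {G : (Fin m₁ ⊕ Fin m₂) × Fin n → ℝ}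
    (hG : ∀ s : Fin n → ℤˣ, IsGeneric (rowVec G) (signVec s)) {δ : ℝ} (hδ : 0 < δ) :
    ((Finset.univ.filter fun a : Finset (Fin m₂) × (Fin n → ℤˣ) =>
        δ ≤ |‖faceResid (rowVec G) a.1 (signVec a.2)‖ ^ 2 -
          ((n - (m₁ + a.1.card) : ℕ) : ℝ)|).card : ℝ) ≤
      2 ^ (m₂ + n) * ((2 * n) / δ ^ 2) := by
  have h := card_filter_mul_sq_le (fun a : Finset (Fin m₂) × (Fin n → ℤˣ) =>
    ‖faceResid (rowVec G) a.1 (signVec a.2)‖ ^ 2 - ((n - (m₁ + a.1.card) : ℕ) : ℝ)) hδ.le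
  rw [← mul_div_assoc, le_div_iff₀ (by positivity)]
  refine h.trans ?_
  rw [Fintype.sum_prod_type]
  have h1 : ∀ S : Finset (Fin m₂), ∑ s : Fin n → ℤˣ,
      (‖faceResid (rowVec G) S (signVec s)‖ ^ 2 - ((n - (m₁ + S.card) : ℕ) : ℝ)) ^ 2 ≤
      2 ^ n * (2 * n) := by
    intro S
    have hr := finrank_orthogonal_span_of_isGeneric hG (Finset.univ.disjSum S)
    have := sum_sq_norm_starProjection_signVec_sub_finrank_le
      (Submodule.span ℝ (rowVec G '' (Finset.univ.disjSum S : Finset (Fin m₁ ⊕ Fin m₂))))ᗮ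
    rw [hr, Finset.card_disjSum, Finset.card_fin, Fintype.card_fin] at this
    exact this
  refine (Finset.sum_le_sum fun S _ => h1 S).trans (le_of_eq ?_)
  rw [Finset.sum_const, Finset.card_univ, Fintype.card_finset, Fintype.card_fin, nsmul_eq_mul]
  push_cast
  ring

theorem faceResid_eq_zero_of_le {G : (Fin m₁ ⊕ Fin m₂) × Fin n → ℝ}
    (hG : ∀ s : Fin n → ℤˣ, IsGeneric (rowVec G) (signVec s)) {S : Finset (Fin m₂)}
    (hS : n ≤ m₁ + S.card) (v : EuclideanSpace ℝ (Fin n)) : faceResid (rowVec G) S v = 0 := by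
  have hr := finrank_orthogonal_span_of_isGeneric hG (Finset.univ.disjSum S)
  rw [Finset.card_disjSum, Finset.card_fin, Fintype.card_fin, Nat.sub_eq_zero_of_le hS,
    Submodule.finrank_eq_zero] at hr
  have := Submodule.starProjection_apply_mem (Submodule.span ℝ
    (rowVec G '' (Finset.univ.disjSum S : Finset (Fin m₁ ⊕ Fin m₂))))ᗮ v
  exact (Submodule.mem_bot ℝ).1 (hr.le this)

open Classical in
-- This reduces a tail probability of the random program to a count over pairs `(S, s)` for one
-- generic array.
theorem measure_le_of_card_le {p : ℝ → Prop} (hp : MeasurableSet {a | p a}) {C : ℝ}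
    (h : ∀ G : (Fin m₁ ⊕ Fin m₂) × Fin n → ℝ,
      (∀ s : Fin n → ℤˣ, IsGeneric (rowVec G) (signVec s)) →
      ((Finset.univ.filter fun a : Finset (Fin m₂) × (Fin n → ℤˣ) =>
        p ‖faceResid (rowVec G) a.1 (signVec a.2)‖).card : ℝ) ≤ 2 ^ (m₂ + n) * C) :
    stdGaussianArray ((Fin m₁ ⊕ Fin m₂) × Fin n) {G | p (-arrayValue G)} ≤ ENNReal.ofReal C := by
  have hT : MeasurableSet {G : (Fin m₁ ⊕ Fin m₂) × Fin n → ℝ | p (-arrayValue G)} :=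
    measurable_arrayValue.neg hp
  have hgen : ∀ᵐ G ∂stdGaussianArray ((Fin m₁ ⊕ Fin m₂) × Fin n),
      ∀ s : Fin n → ℤˣ, IsGeneric (rowVec G) (signVec s) :=
    ae_all_iff.2 fun s => ae_isGeneric _
  have key := card_mul_measure_le
    (Φ := fun a : (Fin m₂ → ℤˣ) × (Fin n → ℤˣ) => flipArray (m₁ := m₁) a.1 a.2)
    (fun a => measurePreserving_sgn_mul _) hT (C := ENNReal.ofReal (2 ^ (m₂ + n) * C)) (by
      filter_upwards [hgen] with G hG
      rw [← ENNReal.ofReal_natCast]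
      refine ENNReal.ofReal_le_ofReal ?_
      have := h G hG
      rw [← card_filter_arrayValue hG p] at this
      exact this)
  have hcard : (Fintype.card ((Fin m₂ → ℤˣ) × (Fin n → ℤˣ)) : ℝ≥0∞) =
      ENNReal.ofReal (2 ^ (m₂ + n)) := by
    rw [← ENNReal.ofReal_natCast]
    congr 1
    simp [pow_add]
  rw [hcard, ENNReal.ofReal_mul (by positivity)] at key
  exact (ENNReal.mul_le_mul_iff_right (by simp) (by simp)).1 key

/-- The squared optimal value concentrates around `max 0 (n - m₁ - m₂ / 2)`. -/
theorem measure_arrayValue_sq_sub_ge_le {δ : ℝ} (hδ : 0 < δ) :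
    stdGaussianArray ((Fin m₁ ⊕ Fin m₂) × Fin n)
      {G | 2 * δ ≤ |(-arrayValue G) ^ 2 - max 0 ((n : ℝ) - m₁ - m₂ / 2)|} ≤
      ENNReal.ofReal ((m₂ / 4 + 2 * n) / δ ^ 2) := by
  classical
  refine measure_le_of_card_le (p := fun a => 2 * δ ≤ |a ^ 2 - max 0 ((n : ℝ) - m₁ - m₂ / 2)|)
    (measurableSet_le measurable_const (by fun_prop)) fun G hG => ?_
  have h1 := card_filter_card_sub_half_le (m₂ := m₂) (n := n) hδ
  have h2 := card_filter_norm_faceResid_sub_le hG hδ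
  rw [add_div, mul_add]
  refine le_trans ?_ (add_le_add h1 h2)
  rw [← Nat.cast_add, Nat.cast_le]
  refine le_trans (Finset.card_le_card ?_) (Finset.card_union_le _ _)
  rintro ⟨S, s⟩ ha
  simp only [Finset.mem_filter, Finset.mem_univ, true_and, Finset.mem_union] at ha ⊢
  by_contra! hcon
  obtain ⟨h3, h4⟩ := hcon
  have h5 : ((n - (m₁ + S.card) : ℕ) : ℝ) = max 0 ((n : ℝ) - m₁ - S.card) := by
    rcases le_total n (m₁ + S.card) with hle | hle
    · rw [Nat.sub_eq_zero_of_le hle, max_eq_left, Nat.cast_zero]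
      have : (n : ℝ) ≤ m₁ + S.card := by exact_mod_cast hle
      linarith
    · have : (m₁ + S.card : ℝ) ≤ n := by exact_mod_cast hle
      rw [Nat.cast_sub hle, max_eq_right (by linarith)]
      push_cast
      ring
  rw [h5] at h4
  -- Truncation at zero is 1-Lipschitz, so the deviation of `|S|` and that of the squared norm, each
  -- below `δ`, add up to less than `2 * δ`.
  have h6 := abs_max_sub_max_le_abs ((n : ℝ) - m₁ - S.card) ((n : ℝ) - m₁ - m₂ / 2) 0
  rw [max_comm _ (0 : ℝ), max_comm _ (0 : ℝ)] at h6
  have h7 : |(n : ℝ) - m₁ - S.card - ((n : ℝ) - m₁ - m₂ / 2)| = |(S.card : ℝ) - m₂ / 2| := by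
    rw [← abs_neg]
    congr 1
    ring
  have h8 := abs_sub_le (‖faceResid (rowVec G) S (signVec s)‖ ^ 2)
    (max 0 ((n : ℝ) - m₁ - S.card)) (max 0 ((n : ℝ) - m₁ - m₂ / 2))
  linarith

/-- With more constraints than degrees of freedom the optimal value is unlikely to be nonzero. -/
theorem measure_arrayValue_ne_zero_le {δ : ℝ} (hδ : 0 < δ)
    (h : (n : ℝ) + δ ≤ m₁ + m₂ / 2) :
    stdGaussianArray ((Fin m₁ ⊕ Fin m₂) × Fin n) {G | -arrayValue G ≠ 0} ≤
      ENNReal.ofReal ((m₂ / 4) / δ ^ 2) := by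
  classical
  refine measure_le_of_card_le (p := fun a => a ≠ 0)
    (measurableSet_singleton (0 : ℝ)).compl fun G hG => ?_
  refine le_trans ?_ (card_filter_card_sub_half_le (m₂ := m₂) (n := n) hδ)
  rw [Nat.cast_le]
  refine Finset.card_le_card ?_
  rintro ⟨S, s⟩ ha
  simp only [Finset.mem_filter, Finset.mem_univ, true_and] at ha ⊢
  -- A nonzero residual needs a positive-dimensional complement, which forces `|S|` below `m₂ / 2`
  -- by more than `δ`.
  have hlt : m₁ + S.card < n := by
    by_contra hcon
    exact ha (by rw [faceResid_eq_zero_of_le hG (not_lt.1 hcon), norm_zero])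
  have hlt' : (m₁ + S.card : ℝ) < n := by exact_mod_cast hlt
  rw [le_abs]
  right
  linarith

end Tail

end RandomLinearProgram

end

noncomputable section

namespace RandomLinearProgram

open scoped ENNReal

/-! ### Asymptotics -/

section Asymptotics

theorem measure_xiH {Ω : Type*} [MeasurableSpace Ω] {μ : Measure Ω} {m₁ m₂ n : ℕ}
    {A : Ω → Matrix (Fin m₁) (Fin n) ℝ} {B : Ω → Matrix (Fin m₂) (Fin n) ℝ}
    (h : IsIIDStdGaussian μ A B) {p : ℝ → Prop} (hp : MeasurableSet {a | p a}) :
    μ {ω | p (xiH fLp (A ω) (B ω))} =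
      stdGaussianArray ((Fin m₁ ⊕ Fin m₂) × Fin n) {G | p (arrayValue G)} := by
  have hlaw := h.indep.hasLaw_pi h.hasLaw
  have hT : MeasurableSet {G : (Fin m₁ ⊕ Fin m₂) × Fin n → ℝ | p (arrayValue G)} :=
    measurable_arrayValue hp
  rw [stdGaussianArray, ← hlaw.map_eq, Measure.map_apply_of_aemeasurable hlaw.aemeasurable hT]
  rfl

theorem xiH_nonpos {m₁ m₂ n : ℕ} (A : Matrix (Fin m₁) (Fin n) ℝ)
    (B : Matrix (Fin m₂) (Fin n) ℝ) : xiH fLp A B ≤ 0 :=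
  (isLeast_xiH A B).2 ⟨0, by simp [feasible], by simp [fLp]⟩

/-- Only subadditivity is used, so the events need not be measurable. -/
theorem tendsto_measure_one_of_compl_subset {Ω : ℕ → Type*} [∀ n, MeasurableSpace (Ω n)]
    {μ : ∀ n, Measure (Ω n)} [∀ n, IsProbabilityMeasure (μ n)] {E F : ∀ n, Set (Ω n)}
    (hF : Tendsto (fun n => μ n (F n)) atTop (𝓝 0)) (h : ∀ᶠ n in atTop, (E n)ᶜ ⊆ F n) :
    Tendsto (fun n => μ n (E n)) atTop (𝓝 1) := by
  have h1 : Tendsto (fun n => 1 - μ n (F n)) atTop (𝓝 1) := by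
    simpa using ENNReal.Tendsto.sub tendsto_const_nhds hF (Or.inl ENNReal.one_ne_top)
  refine tendsto_of_tendsto_of_tendsto_of_le_of_le' h1 tendsto_const_nhds ?_
    (Eventually.of_forall fun n => prob_le_one)
  filter_upwards [h] with n hn
  rw [tsub_le_iff_right]
  calc (1 : ℝ≥0∞) = μ n (E n ∪ (E n)ᶜ) := by rw [Set.union_compl_self, measure_univ]
    _ ≤ μ n (E n) + μ n (E n)ᶜ := measure_union_le _ _
    _ ≤ μ n (E n) + μ n (F n) := by gcongr

theorem tendsto_measure_one_mono {Ω : ℕ → Type*} [∀ n, MeasurableSpace (Ω n)]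
    {μ : ∀ n, Measure (Ω n)} [∀ n, IsProbabilityMeasure (μ n)] {E F : ∀ n, Set (Ω n)}
    (hE : Tendsto (fun n => μ n (E n)) atTop (𝓝 1)) (h : ∀ᶠ n in atTop, E n ⊆ F n) :
    Tendsto (fun n => μ n (F n)) atTop (𝓝 1) :=
  tendsto_of_tendsto_of_tendsto_of_le_of_le' hE tendsto_const_nhds
    (h.mono fun _ hn => measure_mono hn) (Eventually.of_forall fun _ => prob_le_one)

/-- `Real.sqrt` vanishes on nonpositive reals, which absorbs the case distinction. -/
theorem xiDl_eq (ε₁ ε₅ α₁ α₂ : ℝ) (n : ℕ) :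
    xiDl ε₁ ε₅ α₁ α₂ n = -√(1 - sqrtDl ε₁ ε₅ α₁ α₂ ^ 2) * √n := by
  unfold xiDl
  split_ifs with h
  · rfl
  · rw [Real.sqrt_eq_zero_of_nonpos (by linarith)]
    simp

theorem xiDu_eq (ε₁ ε₅ α₁ α₂ : ℝ) (n : ℕ) :
    xiDu ε₁ ε₅ α₁ α₂ n = -√(1 - sqrtDu ε₁ ε₅ α₁ α₂ ^ 2) * √n := by
  unfold xiDu
  split_ifs with h
  · rfl
  · rw [Real.sqrt_eq_zero_of_nonpos (by linarith)]
    simp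

variable {α₁ α₂ : ℝ} {m₁ m₂ : ℕ → ℕ}

theorem tendsto_ofReal_tail_bound (hm₂ : Tendsto (fun n : ℕ => (m₂ n : ℝ) / n) atTop (𝓝 α₂))
    (c : ℝ) {η : ℝ} (hη : 0 < η) :
    Tendsto (fun n : ℕ => ENNReal.ofReal (((m₂ n : ℝ) / 4 + c * n) / (η * n) ^ 2)) atTop
      (𝓝 0) := by
  have h1 : Tendsto (fun n : ℕ => ((m₂ n : ℝ) / n / 4 + c) / η ^ 2 * (1 / (n : ℝ))) atTop
      (𝓝 ((α₂ / 4 + c) / η ^ 2 * 0)) :=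
    (((hm₂.div_const 4).add_const c).div_const (η ^ 2)).mul tendsto_one_div_atTop_nhds_zero_nat
  rw [mul_zero] at h1
  have h2 := ENNReal.tendsto_ofReal h1
  rw [ENNReal.ofReal_zero] at h2
  refine h2.congr' ?_
  filter_upwards [eventually_gt_atTop 0] with n hn
  have hn' : (0 : ℝ) < n := by exact_mod_cast hn
  congr 1
  field_simp

variable {Ω : ℕ → Type*} [∀ n, MeasurableSpace (Ω n)] {μ : ∀ n, Measure (Ω n)}
  [∀ n, IsProbabilityMeasure (μ n)]
  {A : ∀ n, Ω n → Matrix (Fin (m₁ n)) (Fin n) ℝ} {B : ∀ n, Ω n → Matrix (Fin (m₂ n)) (Fin n) ℝ}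

/-- The optimal value, scaled by `√n`, converges in probability. -/
theorem tendsto_measure_abs_xiH_add_le
    (hm₁ : Tendsto (fun n : ℕ => (m₁ n : ℝ) / n) atTop (𝓝 α₁))
    (hm₂ : Tendsto (fun n : ℕ => (m₂ n : ℝ) / n) atTop (𝓝 α₂))
    (hAB : ∀ n, IsIIDStdGaussian (μ n) (A n) (B n)) {δ : ℝ} (hδ : 0 < δ) :
    Tendsto (fun n => μ n {ω | |xiH fLp (A n ω) (B n ω) + √(1 - (α₁ + α₂ / 2)) * √(n : ℝ)| ≤
      δ * √(n : ℝ)}) atTop (𝓝 1) := by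
  -- The fluctuation costs `2 * η` and the limit of the centre costs `η`, together less than `δ ^
  -- 2`. For nonnegative `a`, `c`, however, `|c - a| > δ` forces `|c ^ 2 - a ^ 2| > δ ^ 2`.
  set η : ℝ := δ ^ 2 / 4 with hη
  have hη0 : 0 < η := by positivity
  set c : ℝ := √(1 - (α₁ + α₂ / 2)) with hc
  have hc2 : c ^ 2 = max 0 (1 - (α₁ + α₂ / 2)) := by
    rcases le_total 0 (1 - (α₁ + α₂ / 2)) with h | h
    · rw [max_eq_right h, hc, Real.sq_sqrt h]
    · rw [max_eq_left h, hc, Real.sqrt_eq_zero_of_nonpos h, zero_pow two_ne_zero]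
  have hlim : Tendsto (fun n : ℕ => max 0 (1 - ((m₁ n : ℝ) / n + (m₂ n : ℝ) / n / 2))) atTop
      (𝓝 (c ^ 2)) := by
    rw [hc2]
    exact tendsto_const_nhds.max ((hm₁.add (hm₂.div_const 2)).const_sub 1)
  refine tendsto_measure_one_of_compl_subset (F := fun n => {ω | 2 * (η * n) ≤
    |(-xiH fLp (A n ω) (B n ω)) ^ 2 - max 0 ((n : ℝ) - m₁ n - m₂ n / 2)|}) ?_ ?_
  · refine tendsto_of_tendsto_of_tendsto_of_le_of_le' tendsto_const_nhds
      (tendsto_ofReal_tail_bound hm₂ 2 hη0) (Eventually.of_forall fun _ => zero_le) ?_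
    filter_upwards [eventually_gt_atTop 0] with n hn
    have hn' : (0 : ℝ) < n := by exact_mod_cast hn
    rw [measure_xiH (hAB n) (p := fun a => 2 * (η * n) ≤
      |(-a) ^ 2 - max 0 ((n : ℝ) - m₁ n - m₂ n / 2)|)
      (measurableSet_le measurable_const (by fun_prop))]
    exact measure_arrayValue_sq_sub_ge_le (mul_pos hη0 hn')
  · filter_upwards [eventually_gt_atTop 0, (tendsto_order.1 hlim).1 (c ^ 2 - η) (by linarith),
      (tendsto_order.1 hlim).2 (c ^ 2 + η) (by linarith)] with n hn hlo hhi
    have hn' : (0 : ℝ) < n := by exact_mod_cast hn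
    intro ω hω
    simp only [Set.mem_compl_iff, Set.mem_ofPred_eq, not_le] at hω ⊢
    by_contra! hcon
    set a : ℝ := -xiH fLp (A n ω) (B n ω) / √n with ha
    have hsn : 0 < √(n : ℝ) := Real.sqrt_pos.2 hn'
    have hxi : xiH fLp (A n ω) (B n ω) = -(a * √n) := by
      rw [ha, div_mul_cancel₀ _ hsn.ne', neg_neg]
    have ha0 : 0 ≤ a := div_nonneg (neg_nonneg.2 (xiH_nonpos _ _)) hsn.le
    have hmax : max 0 ((n : ℝ) - m₁ n - m₂ n / 2) =
        n * max 0 (1 - ((m₁ n : ℝ) / n + (m₂ n : ℝ) / n / 2)) := by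
      rw [mul_max_of_nonneg _ _ hn'.le, mul_zero]
      congr 1
      field_simp
      ring
    rw [hxi, neg_neg, mul_pow, Real.sq_sqrt hn'.le, hmax, mul_comm (a ^ 2), ← mul_sub, abs_mul,
      abs_of_pos hn'] at hcon
    have h1 : |a ^ 2 - max 0 (1 - ((m₁ n : ℝ) / n + (m₂ n : ℝ) / n / 2))| < 2 * η := by
      by_contra! hge
      nlinarith
    rw [hxi, show -(a * √(n : ℝ)) + c * √n = (c - a) * √n by ring, abs_mul,
      abs_of_pos hsn] at hω
    have h2 : δ < |c - a| := lt_of_mul_lt_mul_right hω hsn.le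
    have hc0 : 0 ≤ c := Real.sqrt_nonneg _
    rw [abs_lt] at h1
    rcases lt_abs.1 h2 with h3 | h3
    · nlinarith [mul_nonneg ha0 (by linarith : 0 ≤ c - a)]
    · nlinarith [mul_nonneg hc0 (by linarith : 0 ≤ a - c)]

/-- Above the threshold the optimal value vanishes with high probability. -/
theorem tendsto_measure_xiH_eq_zero
    (hm₁ : Tendsto (fun n : ℕ => (m₁ n : ℝ) / n) atTop (𝓝 α₁))
    (hm₂ : Tendsto (fun n : ℕ => (m₂ n : ℝ) / n) atTop (𝓝 α₂))
    (hAB : ∀ n, IsIIDStdGaussian (μ n) (A n) (B n)) (hα : 1 < α₁ + α₂ / 2) :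
    Tendsto (fun n => μ n {ω | xiH fLp (A n ω) (B n ω) = 0}) atTop (𝓝 1) := by
  -- Half the excess over the threshold: the other half absorbs the convergence of the ratios.
  set η : ℝ := (α₁ + α₂ / 2 - 1) / 2 with hη
  have hη0 : 0 < η := by linarith
  refine tendsto_measure_one_of_compl_subset
    (F := fun n => {ω | -xiH fLp (A n ω) (B n ω) ≠ 0}) ?_ (Eventually.of_forall fun n ω hω => ?_)
  · refine tendsto_of_tendsto_of_tendsto_of_le_of_le' tendsto_const_nhds
      (tendsto_ofReal_tail_bound hm₂ 0 hη0) (Eventually.of_forall fun _ => zero_le) ?_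
    filter_upwards [eventually_gt_atTop 0, (tendsto_order.1 (hm₁.add (hm₂.div_const 2))).1
      (1 + η) (by linarith)] with n hn hlo
    have hn' : (0 : ℝ) < n := by exact_mod_cast hn
    rw [measure_xiH (hAB n) (p := fun a => -a ≠ 0)
      ((measurableSet_singleton (0 : ℝ)).compl.preimage measurable_neg), zero_mul, add_zero]
    refine measure_arrayValue_ne_zero_le (mul_pos hη0 hn') ?_
    have h1 := mul_le_mul_of_nonneg_right hlo.le hn'.le
    have h2 : ((m₁ n : ℝ) / n + (m₂ n : ℝ) / n / 2) * n = m₁ n + m₂ n / 2 := by field_simp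
    linarith
  · simpa using hω

end Asymptotics

end RandomLinearProgram

end


/-! ### Deduction of the stated bounds from convergence in probability -/

open RandomLinearProgram in
theorem mainTheorem3 {α₁ α₂ : ℝ} {m₁ m₂ : ℕ → ℕ}
    (hm₁ : Tendsto (fun n : ℕ => (m₁ n : ℝ) / n) atTop (𝓝 α₁))
    (hm₂ : Tendsto (fun n : ℕ => (m₂ n : ℝ) / n) atTop (𝓝 α₂))
    {Ω : ℕ → Type*} [∀ n, MeasurableSpace (Ω n)]
    (μ : ∀ n, Measure (Ω n)) [∀ n, IsProbabilityMeasure (μ n)]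
    (A : ∀ n, Ω n → Matrix (Fin (m₁ n)) (Fin n) ℝ)
    (B : ∀ n, Ω n → Matrix (Fin (m₂ n)) (Fin n) ℝ)
    (hAB : ∀ n, IsIIDStdGaussian (μ n) (A n) (B n)) :
    (∀ ε₁ ε₅ : ℝ, 0 < ε₁ → 0 < ε₅ → 0 ≤ sqrtDl ε₁ ε₅ α₁ α₂ →
      (α₁ + α₂ / 2 < 1 →
        Tendsto (fun n => μ n {ω | xiDl ε₁ ε₅ α₁ α₂ n < xiH fLp (A n ω) (B n ω) ∧
          xiH fLp (A n ω) (B n ω) < xiDu ε₁ ε₅ α₁ α₂ n}) atTop (𝓝 1)) ∧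
      (sqrtDl ε₁ ε₅ α₁ α₂ < 1 →
        Tendsto (fun n => μ n {ω | xiDl ε₁ ε₅ α₁ α₂ n < xiH fLp (A n ω) (B n ω) ∧
          xiH fLp (A n ω) (B n ω) ≤ xiDu ε₁ ε₅ α₁ α₂ n}) atTop (𝓝 1)) ∧
      Tendsto (fun n => μ n {ω | xiDl ε₁ ε₅ α₁ α₂ n ≤ xiH fLp (A n ω) (B n ω) ∧
        xiH fLp (A n ω) (B n ω) ≤ xiDu ε₁ ε₅ α₁ α₂ n}) atTop (𝓝 1)) ∧
    (α₁ + α₂ / 2 < 1 → ∀ δ : ℝ, 0 < δ →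
      Tendsto (fun n => μ n {ω | |xiH fLp (A n ω) (B n ω) -
        (-√(1 - α₁ - α₂ / 2) * √(n : ℝ))| ≤ δ * √(n : ℝ)}) atTop (𝓝 1)) ∧
    (1 ≤ α₁ + α₂ / 2 → ∀ δ : ℝ, 0 < δ →
      Tendsto (fun n => μ n {ω | |xiH fLp (A n ω) (B n ω)| ≤ δ * √(n : ℝ)}) atTop (𝓝 1)) ∧
    (1 < α₁ + α₂ / 2 →
      Tendsto (fun n => μ n {ω | xiH fLp (A n ω) (B n ω) = 0}) atTop (𝓝 1)) := by
  have hα₁ : 0 ≤ α₁ := ge_of_tendsto' hm₁ fun n => by positivity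
  have hα₂ : 0 ≤ α₂ := ge_of_tendsto' hm₂ fun n => by positivity
  have hlim := fun (δ : ℝ) (hδ : 0 < δ) => tendsto_measure_abs_xiH_add_le hm₁ hm₂ hAB hδ
  have hd0 : 0 ≤ √(α₁ + α₂ / 2) := Real.sqrt_nonneg _
  have hd2 : √(α₁ + α₂ / 2) ^ 2 = α₁ + α₂ / 2 := Real.sq_sqrt (by positivity)
  refine ⟨fun ε₁ ε₅ hε₁ hε₅ hl => ?_, fun hα δ hδ => ?_, fun hα δ hδ => ?_,
    fun hα => tendsto_measure_xiH_eq_zero hm₁ hm₂ hAB hα⟩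
  · set dl := sqrtDl ε₁ ε₅ α₁ α₂ with hdl
    set du := sqrtDu ε₁ ε₅ α₁ α₂ with hdu
    have hdl_lt : dl < √(α₁ + α₂ / 2) := by
      rw [hdl, sqrtDl]
      nlinarith [mul_nonneg hε₁.le hd0]
    have hdu_gt : √(α₁ + α₂ / 2) < du := by
      rw [hdu, sqrtDu]
      nlinarith [mul_nonneg hε₁.le hd0]
    have hdl2 : dl ^ 2 < α₁ + α₂ / 2 := by nlinarith
    have hdu2 : α₁ + α₂ / 2 < du ^ 2 := by nlinarith
    have strict : α₁ + α₂ / 2 < 1 →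
        Tendsto (fun n => μ n {ω | xiDl ε₁ ε₅ α₁ α₂ n < xiH fLp (A n ω) (B n ω) ∧
          xiH fLp (A n ω) (B n ω) < xiDu ε₁ ε₅ α₁ α₂ n}) atTop (𝓝 1) := by
      intro hα
      have h1 : √(1 - (α₁ + α₂ / 2)) < √(1 - dl ^ 2) :=
        Real.sqrt_lt_sqrt (by linarith) (by linarith)
      have h2 : √(1 - du ^ 2) < √(1 - (α₁ + α₂ / 2)) :=
        (Real.sqrt_lt_sqrt_iff_of_pos (by linarith)).2 (by linarith)
      -- The limit lies strictly between the two scaled bounds; `δ` is below both gaps.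
      obtain ⟨δ, hδ, hδlt⟩ := exists_between (lt_min (sub_pos.2 h1) (sub_pos.2 h2))
      obtain ⟨hδ1, hδ2⟩ := lt_min_iff.1 hδlt
      refine tendsto_measure_one_mono (hlim δ hδ) ?_
      filter_upwards [eventually_gt_atTop 0] with n hn ω hω
      have hn' : 0 < √(n : ℝ) := Real.sqrt_pos.2 (by exact_mod_cast hn)
      rw [Set.mem_ofPred_eq, abs_le] at hω
      obtain ⟨h3, h4⟩ := hω
      refine ⟨?_, ?_⟩
      · rw [xiDl_eq, ← hdl]
        nlinarith
      · rw [xiDu_eq, ← hdu]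
        nlinarith
    have hxiDu : 1 ≤ α₁ + α₂ / 2 → ∀ n, xiDu ε₁ ε₅ α₁ α₂ n = 0 := fun hα n => by
      rw [xiDu_eq, ← hdu, Real.sqrt_eq_zero_of_nonpos (by linarith)]
      simp
    have semistrict : dl < 1 →
        Tendsto (fun n => μ n {ω | xiDl ε₁ ε₅ α₁ α₂ n < xiH fLp (A n ω) (B n ω) ∧
          xiH fLp (A n ω) (B n ω) ≤ xiDu ε₁ ε₅ α₁ α₂ n}) atTop (𝓝 1) := by
      intro hdl1
      rcases lt_or_ge (α₁ + α₂ / 2) 1 with hα | hα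
      · exact tendsto_measure_one_mono (strict hα)
          (Eventually.of_forall fun n ω hω => ⟨hω.1, hω.2.le⟩)
      -- Here the left root is zero and `0 ≤ dl < 1` makes the right one positive; the upper bound
      -- is just `ξ_h ≤ 0`.
      have h1 : √(1 - (α₁ + α₂ / 2)) < √(1 - dl ^ 2) :=
        (Real.sqrt_lt_sqrt_iff_of_pos (by nlinarith)).2 (by linarith)
      obtain ⟨δ, hδ, hδ1⟩ := exists_between (sub_pos.2 h1)
      refine tendsto_measure_one_mono (hlim δ hδ) ?_
      filter_upwards [eventually_gt_atTop 0] with n hn ω hω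
      have hn' : 0 < √(n : ℝ) := Real.sqrt_pos.2 (by exact_mod_cast hn)
      rw [Set.mem_ofPred_eq, abs_le] at hω
      obtain ⟨h3, -⟩ := hω
      refine ⟨?_, (hxiDu hα n).symm ▸ xiH_nonpos _ _⟩
      rw [xiDl_eq, ← hdl]
      nlinarith
    refine ⟨strict, semistrict, ?_⟩
    rcases lt_or_ge dl 1 with hdl1 | hdl1
    · exact tendsto_measure_one_mono (semistrict hdl1)
        (Eventually.of_forall fun n ω hω => ⟨hω.1.le, hω.2⟩)
    -- With `dl ≥ 1` both bounds are zero, so approximate concentration is useless and exact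
    -- vanishing is required; `dl ^ 2 < α₁ + α₂ / 2` supplies it.
    · have hα : 1 < α₁ + α₂ / 2 := by nlinarith
      refine tendsto_measure_one_mono (tendsto_measure_xiH_eq_zero hm₁ hm₂ hAB hα)
        (Eventually.of_forall fun n ω hω => ?_)
      have hω' : xiH fLp (A n ω) (B n ω) = 0 := hω
      refine ⟨?_, ?_⟩
      · rw [hω', xiDl_eq, ← hdl, Real.sqrt_eq_zero_of_nonpos (by nlinarith)]
        simp
      · rw [hω', hxiDu hα.le]
  · convert hlim δ hδ using 6
    rw [sub_sub, neg_mul, sub_neg_eq_add]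
  · convert hlim δ hδ using 6
    rw [Real.sqrt_eq_zero_of_nonpos (by linarith), zero_mul, add_zero]
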